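/- Conventions. A Petri net $N$ consists of a set of places, a set of transitions, and for each transition a finite multiset of input places and a finite multiset of output places. Fix, for each transition, an ordering of its inputs and of its outputs. $\mathfrak{F}(N)$ denotes the free symmetric strict monoidal category on $N$: its objects are strings of places, with concatenation as tensor product, and its morphisms are generated, under composition, tensor product and symmetries, by one morphism for each transition, subject only to the axioms of a symmetric strict monoidal category. Let $\mathbf{Set}_*$ be the category of sets and partial functions and $\mathbf{Span}$ the category of sets and isomorphism classes of spans of sets, both symmetric monoidal under the cartesian product of sets and replaced by their strictifications (objects are finite lists of sets, read as their product). A guarded net (respectively, a guarded net with side effects) is a Petri net $N$ with a strict symmetric monoidal functor $N^\sharp:\mathfrak{F}(N)\to\mathbf{Set}_*$ (respectively, $N^\sharp:\mathfrak{F}(N)\to\mathbf{Span}$). A marking is a pair $(X,x)$ with $X$ an object of $\mathfrak{F}(N)$ and $x\in N^\sharp X$. The marking $(Y,y)$ is reachable from $(X,x)$ if there is a morphism $f:X\to Y$ of $\mathfrak{F}(N)$ such that $N^\sharp f$ is defined at $x$ with value $y$ (respectively, such that some element $s$ of the apex of the span $N^\sharp f$ lies over $(x,y)$). The internalization $\int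 N^\sharp$ has the markings as objects; its morphisms $(X,x)\to(Y,y)$ are the $f:X\to Y$ in $\mathfrak{F}(N)$ with $N^\sharp f(x)=y$ (respectively, the pairs $(f,s)$ with $f:X\to Y$ in $\mathfrak{F}(N)$ and $s$ in the apex of $N^\sharp f$ lying over $(x,y)$). Its underlying unguarded net $\mathfrak{U}(\int N^\sharp)$ has as places the generating objects, i.e. the pairs $(p,x)$ with $p$ a place of $N$ and $x\in N^\sharp p$, and as transitions the generating morphisms, i.e. the morphisms of $\int N^\sharp$ lying over the generating morphism of a transition of $N$; the inputs and outputs of a transition are the generating objects that make up its source and its target, where an object $(p_1\cdots p_n,x)$ is identified with the string $(p_1,x_1)\cdots(p_n,x_n)$ through $N^\sharp(p_1\cdots p_n)=N^\sharp p_1\otimes\cdots\otimes N^\sharp p_n$, $x=(x_1,\dots,x_n)$. Through this identification markings of $N$ are objects of $\mathfrak{F}(\mathfrak{U}(\int N^\sharp))$, and one object is reachable from another in the unguarded net $\mathfrak{U}(\int N^\sharp)$ if $\mathfrak{F}(\mathfrak{U}(\int N^\sharp))$ has a morphism from the latter to the former. Theorem. Let $(N,N^\sharp)$ be a guarded net,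 or a guarded net with side effects, and let $(X,x)$ and $(Y,y)$ be markings. Then $(Y,y)$ is reachable from $(X,x)$ in $(N,N^\sharp)$ if and only if $(Y,y)$ is reachable from $(X,x)$ in the net $\mathfrak{U}(\int N^\sharp)$. -/

import Mathlib

open CategoryTheory MonoidalCategory

universe u v w

namespace GuardedNets

/-! ### Strict symmetric monoidal categories and functors -/

/-- A monoidal category is strict when tensoring is associative and unital on the nose and the
structure isomorphisms are identities. -/
class StrictMonoidal (C : Type u) [Category.{v} C] [MonoidalCategory C] : Prop where
  unit_tensor (X : C) : 𝟙_ C ⊗ X = X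
  tensor_unit (X : C) : X ⊗ 𝟙_ C = X
  tensor_assoc (X Y Z : C) : (X ⊗ Y) ⊗ Z = X ⊗ (Y ⊗ Z)
  leftUnitor_eq (X : C) : λ_ X = eqToIso (unit_tensor X)
  rightUnitor_eq (X : C) : ρ_ X = eqToIso (tensor_unit X)
  associator_eq (X Y Z : C) : α_ X Y Z = eqToIso (tensor_assoc X Y Z)

/-- A strict symmetric monoidal functor: it preserves the unit, the tensor product of objects and
morphisms, and the symmetries strictly. -/
structure StrictSymmetricFunctor (C : Type*) [Category* C] [MonoidalCategory C]
    [SymmetricCategory C] [StrictMonoidal C] (D : Type*) [Category* D] [MonoidalCategory D]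
    [SymmetricCategory D] [StrictMonoidal D] extends C ⥤ D where
  obj_unit : obj (𝟙_ C) = 𝟙_ D
  obj_tensor (X Y : C) : obj (X ⊗ Y) = obj X ⊗ obj Y
  map_tensor {X X' Y Y' : C} (f : X ⟶ X') (g : Y ⟶ Y') :
    map (f ⊗ₘ g) =
      eqToHom (obj_tensor X Y) ≫ (map f ⊗ₘ map g) ≫ eqToHom (obj_tensor X' Y').symm
  map_braiding (X Y : C) :
    map (β_ X Y).hom =
      eqToHom (obj_tensor X Y) ≫ (β_ (obj X) (obj Y)).hom ≫ eqToHom (obj_tensor Y X).symm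

/-! ### Petri nets and the free symmetric strict monoidal category of a net -/

/-- A Petri net: places, transitions, and a finite multiset of input and output places for each
transition. -/
structure PetriNet where
  Place : Type u
  Trans : Type v
  input : Trans → Multiset Place
  output : Trans → Multiset Place

/-- A choice, for each transition, of an order on its input places and on its output places. -/
structure PetriNet.Ordering (N : PetriNet.{u, v}) where
  src : N.Trans → List N.Place
  tgt : N.Trans → List N.Place
  coe_src (t : N.Trans) : (src t : Multiset N.Place) = N.input t
  coe_tgt (t : N.Trans) : (tgt t : Multiset N.Place) = N.output t

section FreeCategory

variable {N : PetriNet.{u, v}}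

/-- Formal morphisms between strings of places, generated by the transitions of the net. -/
inductive Term (o : N.Ordering) : List N.Place → List N.Place → Type (max u v)
  | id (X : List N.Place) : Term o X X
  | cast {X Y : List N.Place} (h : X = Y) : Term o X Y
  | comp {X Y Z : List N.Place} (f : Term o X Y) (g : Term o Y Z) : Term o X Z
  | tensor {X X' Y Y' : List N.Place} (f : Term o X X') (g : Term o Y Y') :
      Term o (X ++ Y) (X' ++ Y')
  | braid (X Y : List N.Place) : Term o (X ++ Y) (Y ++ X)
  | gen (t : N.Trans) : Term o (o.src t) (o.tgt t)

/-- The congruence generated by the axioms of a symmetric strict monoidal category. -/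
inductive TermEquiv (o : N.Ordering) :
    {X Y : List N.Place} → Term o X Y → Term o X Y → Prop
  | refl {X Y} (f : Term o X Y) : TermEquiv o f f
  | symm {X Y} {f g : Term o X Y} : TermEquiv o f g → TermEquiv o g f
  | trans {X Y} {f g h : Term o X Y} : TermEquiv o f g → TermEquiv o g h → TermEquiv o f h
  | comp_congr {X Y Z} {f f' : Term o X Y} {g g' : Term o Y Z} :
      TermEquiv o f f' → TermEquiv o g g' → TermEquiv o (f.comp g) (f'.comp g')
  | tensor_congr {X X' Y Y'} {f f' : Term o X X'} {g g' : Term o Y Y'} :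
      TermEquiv o f f' → TermEquiv o g g' → TermEquiv o (f.tensor g) (f'.tensor g')
  | id_comp {X Y} (f : Term o X Y) : TermEquiv o ((Term.id X).comp f) f
  | comp_id {X Y} (f : Term o X Y) : TermEquiv o (f.comp (Term.id Y)) f
  | assoc {W X Y Z} (f : Term o W X) (g : Term o X Y) (h : Term o Y Z) :
      TermEquiv o ((f.comp g).comp h) (f.comp (g.comp h))
  | cast_rfl (X) : TermEquiv o (Term.cast (rfl : X = X)) (Term.id X)
  | id_tensor_id (X Y) : TermEquiv o ((Term.id X).tensor (Term.id Y)) (Term.id (X ++ Y))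
  | tensor_comp {X Y Z X' Y' Z'} (f : Term o X Y) (f' : Term o X' Y') (g : Term o Y Z)
      (g' : Term o Y' Z') :
      TermEquiv o ((f.tensor f').comp (g.tensor g')) ((f.comp g).tensor (f'.comp g'))
  | unit_tensor {X Y} (f : Term o X Y) :
      TermEquiv o (((Term.id []).tensor f).comp (Term.cast (List.nil_append Y)))
        ((Term.cast (List.nil_append X)).comp f)
  | tensor_unit {X Y} (f : Term o X Y) :
      TermEquiv o ((f.tensor (Term.id [])).comp (Term.cast (List.append_nil Y)))
        ((Term.cast (List.append_nil X)).comp f)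
  | tensor_assoc {X Y Z X' Y' Z'} (f : Term o X X') (g : Term o Y Y') (h : Term o Z Z') :
      TermEquiv o (((f.tensor g).tensor h).comp (Term.cast (List.append_assoc X' Y' Z')))
        ((Term.cast (List.append_assoc X Y Z)).comp (f.tensor (g.tensor h)))
  | braid_naturality {X Y X' Y'} (f : Term o X X') (g : Term o Y Y') :
      TermEquiv o ((f.tensor g).comp (Term.braid X' Y')) ((Term.braid X Y).comp (g.tensor f))
  | braid_symm (X Y) :
      TermEquiv o ((Term.braid X Y).comp (Term.braid Y X)) (Term.id (X ++ Y))
  | hexagon (X Y Z) :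
      TermEquiv o
        ((Term.cast (List.append_assoc X Y Z)).comp
          ((Term.braid X (Y ++ Z)).comp (Term.cast (List.append_assoc Y Z X))))
        (((Term.braid X Y).tensor (Term.id Z)).comp
          ((Term.cast (List.append_assoc Y X Z)).comp ((Term.id Y).tensor (Term.braid X Z))))

/-- The setoid of formal morphisms. -/
def termSetoid (o : N.Ordering) (X Y : List N.Place) : Setoid (Term o X Y) :=
  ⟨TermEquiv o, ⟨TermEquiv.refl, TermEquiv.symm, TermEquiv.trans⟩⟩

/-- The free symmetric strict monoidal category on a net: objects are strings of places. -/
structure Free (o : N.Ordering) where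
  word : List N.Place

namespace Free

variable {o : N.Ordering}

instance : Category (Free o) where
  Hom X Y := Quotient (termSetoid o X.word Y.word)
  id X := Quotient.mk _ (Term.id X.word)
  comp := Quotient.map₂ Term.comp (fun _ _ hf _ _ hg => TermEquiv.comp_congr hf hg)
  id_comp := by
    rintro X Y ⟨f⟩
    exact Quotient.sound (TermEquiv.id_comp f)
  comp_id := by
    rintro X Y ⟨f⟩
    exact Quotient.sound (TermEquiv.comp_id f)
  assoc := by
    rintro W X Y Z ⟨f⟩ ⟨g⟩ ⟨h⟩
    exact Quotient.sound (TermEquiv.assoc f g h)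

/-- The class of a formal morphism. -/
def homMk {X Y : Free o} (f : Term o X.word Y.word) : X ⟶ Y :=
  Quotient.mk (termSetoid o X.word Y.word) f

/-- The generating morphism given by a transition. -/
def gen (o : N.Ordering) (t : N.Trans) : (⟨o.src t⟩ : Free o) ⟶ ⟨o.tgt t⟩ :=
  homMk (Term.gen t)

theorem homMk_cast {X Y : Free o} (h : X.word = Y.word) :
    (homMk (Term.cast h) : X ⟶ Y) = eqToHom (congrArg Free.mk h) := by
  cases X
  cases Y
  dsimp only at h
  subst h
  exact Quotient.sound (TermEquiv.cast_rfl _)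

/-- Concatenation of morphisms. -/
def tensorMap {X X' Y Y' : Free o} (f : X ⟶ X') (g : Y ⟶ Y') :
    (⟨X.word ++ Y.word⟩ : Free o) ⟶ ⟨X'.word ++ Y'.word⟩ :=
  Quotient.map₂ Term.tensor (fun _ _ hf _ _ hg => TermEquiv.tensor_congr hf hg) f g

theorem tensorMap_id (X Y : Free o) :
    tensorMap (𝟙 X) (𝟙 Y) = 𝟙 (⟨X.word ++ Y.word⟩ : Free o) :=
  Quotient.sound (TermEquiv.id_tensor_id _ _)

theorem tensorMap_eqToHom {X X' Y Y' : Free o} (h : X = X') (h' : Y = Y') :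
    tensorMap (eqToHom h) (eqToHom h') =
      eqToHom (congrArg₂ (fun A B : Free o => (⟨A.word ++ B.word⟩ : Free o)) h h') := by
  subst h h'
  exact tensorMap_id _ _

instance : MonoidalCategoryStruct (Free o) where
  tensorUnit := ⟨[]⟩
  tensorObj X Y := ⟨X.word ++ Y.word⟩
  tensorHom f g := tensorMap f g
  whiskerLeft X _ _ g := tensorMap (𝟙 X) g
  whiskerRight f Y := tensorMap f (𝟙 Y)
  leftUnitor X := eqToIso (congrArg Free.mk (List.nil_append X.word))
  rightUnitor X := eqToIso (congrArg Free.mk (List.append_nil X.word))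
  associator X Y Z := eqToIso (congrArg Free.mk (List.append_assoc X.word Y.word Z.word))

instance : MonoidalCategory (Free o) :=
  MonoidalCategory.ofTensorHom
    (id_tensorHom_id := fun X Y => tensorMap_id X Y)
    (id_tensorHom := fun _ _ _ _ => rfl)
    (tensorHom_id := fun _ _ => rfl)
    (tensorHom_comp_tensorHom := by
      rintro _ _ _ _ _ _ ⟨f⟩ ⟨f'⟩ ⟨g⟩ ⟨g'⟩
      exact Quotient.sound (TermEquiv.tensor_comp f f' g g'))
    (associator_naturality := by
      rintro X Y Z X' Y' Z' ⟨f⟩ ⟨g⟩ ⟨h⟩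
      simp only [eqToIso.hom, MonoidalCategoryStruct.associator]
      erw [← homMk_cast (X := ⟨_⟩) (Y := ⟨_⟩) (List.append_assoc _ _ _),
        ← homMk_cast (X := ⟨_⟩) (Y := ⟨_⟩) (List.append_assoc _ _ _)]
      exact Quotient.sound (TermEquiv.tensor_assoc f g h))
    (leftUnitor_naturality := by
      rintro X Y ⟨f⟩
      simp only [eqToIso.hom, MonoidalCategoryStruct.leftUnitor]
      erw [← homMk_cast (X := ⟨_⟩) (Y := Y) (List.nil_append _),
        ← homMk_cast (X := ⟨_⟩) (Y := X) (List.nil_append _)]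
      exact Quotient.sound (TermEquiv.unit_tensor f))
    (rightUnitor_naturality := by
      rintro X Y ⟨f⟩
      simp only [eqToIso.hom, MonoidalCategoryStruct.rightUnitor]
      erw [← homMk_cast (X := ⟨_⟩) (Y := Y) (List.append_nil _),
        ← homMk_cast (X := ⟨_⟩) (Y := X) (List.append_nil _)]
      exact Quotient.sound (TermEquiv.tensor_unit f))
    (pentagon := by
      intro W X Y Z
      have h1 : (𝟙 Z : Z ⟶ Z) = eqToHom rfl := rfl
      have h2 : (𝟙 W : W ⟶ W) = eqToHom rfl := rfl
      simp only [eqToIso.hom, MonoidalCategoryStruct.associator, h1, h2,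
        MonoidalCategoryStruct.tensorHom]
      rw [tensorMap_eqToHom, tensorMap_eqToHom]
      erw [eqToHom_trans, eqToHom_trans, eqToHom_trans])
    (triangle := by
      intro X Y
      have h1 : (𝟙 X : X ⟶ X) = eqToHom rfl := rfl
      have h2 : (𝟙 Y : Y ⟶ Y) = eqToHom rfl := rfl
      simp only [eqToIso.hom, MonoidalCategoryStruct.associator, h1, h2,
        MonoidalCategoryStruct.tensorHom, MonoidalCategoryStruct.leftUnitor,
        MonoidalCategoryStruct.rightUnitor]
      rw [tensorMap_eqToHom, tensorMap_eqToHom]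
      erw [eqToHom_trans])

instance : StrictMonoidal (Free o) where
  unit_tensor X := congrArg Free.mk (List.nil_append X.word)
  tensor_unit X := congrArg Free.mk (List.append_nil X.word)
  tensor_assoc X Y Z := congrArg Free.mk (List.append_assoc X.word Y.word Z.word)
  leftUnitor_eq _ := rfl
  rightUnitor_eq _ := rfl
  associator_eq _ _ _ := rfl

/-- The symmetries. -/
def braidIso (X Y : Free o) : X ⊗ Y ≅ Y ⊗ X where
  hom := homMk (Term.braid X.word Y.word)
  inv := homMk (Term.braid Y.word X.word)
  hom_inv_id := Quotient.sound (TermEquiv.braid_symm _ _)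
  inv_hom_id := Quotient.sound (TermEquiv.braid_symm _ _)

theorem hexagon_aux (X Y Z : Free o) :
    (α_ X Y Z).hom ≫ (braidIso X (Y ⊗ Z)).hom ≫ (α_ Y Z X).hom =
      ((braidIso X Y).hom ▷ Z) ≫ (α_ Y X Z).hom ≫ (Y ◁ (braidIso X Z).hom) := by
  rw [StrictMonoidal.associator_eq, StrictMonoidal.associator_eq, StrictMonoidal.associator_eq]
  simp only [eqToIso.hom]
  erw [← homMk_cast (X := ⟨_⟩) (Y := ⟨_⟩) (List.append_assoc X.word Y.word Z.word),
    ← homMk_cast (X := ⟨_⟩) (Y := ⟨_⟩) (List.append_assoc Y.word Z.word X.word),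
    ← homMk_cast (X := ⟨_⟩) (Y := ⟨_⟩) (List.append_assoc Y.word X.word Z.word)]
  exact Quotient.sound (TermEquiv.hexagon X.word Y.word Z.word)

instance : BraidedCategory (Free o) where
  braiding := braidIso
  braiding_naturality_right := by
    rintro X Y Z ⟨f⟩
    exact Quotient.sound (TermEquiv.braid_naturality (Term.id X.word) f)
  braiding_naturality_left := by
    rintro X Y ⟨f⟩ Z
    exact Quotient.sound (TermEquiv.braid_naturality f (Term.id Z.word))
  hexagon_forward := hexagon_aux
  hexagon_reverse X Y Z := by
    have h := hexagon_aux Z X Y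
    have h' : (α_ Z X Y ≪≫ braidIso Z (X ⊗ Y) ≪≫ α_ X Y Z) =
        (whiskerRightIso (braidIso Z X) Y ≪≫ α_ X Z Y ≪≫ whiskerLeftIso X (braidIso Z Y)) := by
      ext
      exact h
    have h'' := congrArg Iso.inv h'
    simp only [Iso.trans_inv, whiskerRightIso_inv, whiskerLeftIso_inv, Category.assoc] at h''
    exact h''

instance : SymmetricCategory (Free o) where
  symmetry X Y := (braidIso X Y).hom_inv_id

end Free

end FreeCategory

/-! ### Strictification of a symmetric monoidal category -/

section Strictify

variable {C : Type u} [Category.{v} C] [MonoidalCategory C]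

/-- The tensor product of a list of objects. -/
def tensorList : List C → C
  | [] => 𝟙_ C
  | A :: L => A ⊗ tensorList L

/-- Concatenation of lists corresponds to the tensor product, up to canonical isomorphism. -/
def mergeIso : (A B : List C) → (tensorList A ⊗ tensorList B ≅ tensorList (A ++ B))
  | [], B => λ_ (tensorList B)
  | X :: A, B => α_ X (tensorList A) (tensorList B) ≪≫ whiskerLeftIso X (mergeIso A B)

variable (C) in
/-- The strictification of a monoidal category: objects are finite lists of objects, tensored by
concatenation, and morphisms are the morphisms between their tensor products. -/
structure Strictify where
  objs : List C

namespace Strictify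

/-- The object represented by a list. -/
def toObj (A : Strictify C) : C := tensorList A.objs

/-- Morphisms of the strictification are morphisms between the tensor products. -/
@[ext]
structure Hom (A B : Strictify C) where
  val : A.toObj ⟶ B.toObj

instance : Category.{v} (Strictify C) where
  Hom A B := Hom A B
  id A := ⟨𝟙 A.toObj⟩
  comp f g := ⟨f.val ≫ g.val⟩
  id_comp f := Hom.ext (Category.id_comp f.val)
  comp_id f := Hom.ext (Category.comp_id f.val)
  assoc f g h := Hom.ext (Category.assoc f.val g.val h.val)

variable (C) in
/-- The comparison functor to the original category. -/
def toBase : Strictify C ⥤ C where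
  obj A := A.toObj
  map f := f.val
  map_id _ := rfl
  map_comp _ _ := rfl

instance : (toBase C).Full where
  map_surjective f := ⟨⟨f⟩, rfl⟩

instance : (toBase C).Faithful where
  map_injective h := Hom.ext h

instance : MonoidalCategoryStruct (Strictify C) where
  tensorUnit := ⟨[]⟩
  tensorObj A B := ⟨A.objs ++ B.objs⟩
  tensorHom {A A' B B'} f g :=
    ⟨(mergeIso A.objs B.objs).inv ≫ (f.val ⊗ₘ g.val) ≫ (mergeIso A'.objs B'.objs).hom⟩
  whiskerLeft A B B' g :=
    ⟨(mergeIso A.objs B.objs).inv ≫ (A.toObj ◁ g.val) ≫ (mergeIso A.objs B'.objs).hom⟩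
  whiskerRight {A A'} f B :=
    ⟨(mergeIso A.objs B.objs).inv ≫ (f.val ▷ B.toObj) ≫ (mergeIso A'.objs B.objs).hom⟩
  leftUnitor A := eqToIso (congrArg Strictify.mk (List.nil_append A.objs))
  rightUnitor A := eqToIso (congrArg Strictify.mk (List.append_nil A.objs))
  associator A B D := eqToIso (congrArg Strictify.mk (List.append_assoc A.objs B.objs D.objs))

theorem eqToHom_tensorList_cons (X : C) {A B : List C} (h : A = B) :
    eqToHom (congrArg (fun L => tensorList (X :: L)) h) =
      X ◁ eqToHom (congrArg tensorList h) := by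
  subst h
  simp only [eqToHom_refl, whiskerLeft_id]
  rfl

theorem assoc_step (X : C) {P Q R S T T' U : C} (m : P ⊗ Q ⟶ S) (m' : S ⊗ R ⟶ T) (e : T ⟶ T')
    (n : Q ⊗ R ⟶ U) (k : P ⊗ U ⟶ T')
    (h : (m ▷ R) ≫ m' ≫ e = (α_ P Q R).hom ≫ (P ◁ n) ≫ k) :
    (((α_ X P Q).hom ≫ X ◁ m) ▷ R) ≫ ((α_ X S R).hom ≫ X ◁ m') ≫ X ◁ e =
      (α_ (X ⊗ P) Q R).hom ≫ ((X ⊗ P) ◁ n) ≫ (α_ X P U).hom ≫ X ◁ k := by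
  have h' := congrArg (fun f => X ◁ f) h
  simp only [whiskerLeft_comp] at h'
  simp [h']

theorem toBase_eqToHom {A B : Strictify C} (h : A = B) :
    (toBase C).map (eqToHom h) = eqToHom (congrArg (toBase C).obj h) := by
  subst h
  rfl

theorem mergeIso_assoc (A B D : List C) :
    ((mergeIso A B).hom ▷ tensorList D) ≫ (mergeIso (A ++ B) D).hom ≫
        eqToHom (congrArg tensorList (List.append_assoc A B D)) =
      (α_ _ _ _).hom ≫ (tensorList A ◁ (mergeIso B D).hom) ≫ (mergeIso A (B ++ D)).hom := by
  induction A with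
  | nil =>
    simp [mergeIso, tensorList]
  | cons X A ih =>
    have e : eqToHom (congrArg tensorList (List.append_assoc (X :: A) B D)) =
        X ◁ eqToHom (congrArg tensorList (List.append_assoc A B D)) :=
      eqToHom_tensorList_cons X (List.append_assoc A B D)
    rw [e]
    exact assoc_step X _ _ _ _ _ ih

theorem unit_step (X : C) {P T : C} (m : P ⊗ 𝟙_ C ⟶ T) (e : T ⟶ P)
    (h : m ≫ e = (ρ_ P).hom) :
    ((α_ X P (𝟙_ C)).hom ≫ X ◁ m) ≫ X ◁ e = (ρ_ (X ⊗ P)).hom := by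
  rw [Category.assoc, ← whiskerLeft_comp, h]
  simp

theorem mergeIso_nil (A : List C) :
    (mergeIso A []).hom ≫ eqToHom (congrArg tensorList (List.append_nil A)) =
      (ρ_ (tensorList A)).hom := by
  induction A with
  | nil => simp [mergeIso, tensorList, unitors_equal]
  | cons X A ih =>
    have e : eqToHom (congrArg tensorList (List.append_nil (X :: A))) =
        X ◁ eqToHom (congrArg tensorList (List.append_nil A)) :=
      eqToHom_tensorList_cons X (List.append_nil A)
    rw [e]
    exact unit_step X _ _ ih

/-- The tensor product of lists is compatible with the tensor product of the base. -/
def inducingData : Monoidal.InducingFunctorData (toBase C) where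
  μIso A B := mergeIso A.objs B.objs
  εIso := Iso.refl _
  whiskerLeft_eq _ _ _ _ := rfl
  whiskerRight_eq _ _ := rfl
  tensorHom_eq _ _ := rfl
  associator_eq A B D := by
    have h := mergeIso_assoc A.objs B.objs D.objs
    have h' : eqToHom (congrArg tensorList (List.append_assoc A.objs B.objs D.objs)) =
        ((mergeIso (A.objs ++ B.objs) D.objs).inv ≫
          ((mergeIso A.objs B.objs).inv ⊗ₘ 𝟙 (tensorList D.objs))) ≫ (α_ _ _ _).hom ≫
          (𝟙 (tensorList A.objs) ⊗ₘ (mergeIso B.objs D.objs).hom) ≫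
            (mergeIso A.objs (B.objs ++ D.objs)).hom := by
      rw [id_tensorHom, tensorHom_id, ← h]
      simp
    exact (toBase_eqToHom (congrArg Strictify.mk
      (List.append_assoc A.objs B.objs D.objs))).trans h'
  leftUnitor_eq A := by
    have h' : 𝟙 (tensorList A.objs) =
        ((λ_ (tensorList A.objs)).inv ≫ (𝟙 (𝟙_ C) ⊗ₘ 𝟙 (tensorList A.objs))) ≫
          (λ_ (tensorList A.objs)).hom := by
      simp
    exact h'
  rightUnitor_eq A := by
    have h := mergeIso_nil A.objs
    have h' : eqToHom (congrArg tensorList (List.append_nil A.objs)) =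
        ((mergeIso A.objs []).inv ≫ (𝟙 (tensorList A.objs) ⊗ₘ 𝟙 (𝟙_ C))) ≫
          (ρ_ (tensorList A.objs)).hom := by
      rw [← h]
      erw [id_tensorHom_id, Category.comp_id, Iso.inv_hom_id_assoc]
    exact (toBase_eqToHom (congrArg Strictify.mk (List.append_nil A.objs))).trans h'

instance : MonoidalCategory (Strictify C) :=
  Monoidal.induced (toBase C) inducingData

instance : StrictMonoidal (Strictify C) where
  unit_tensor A := congrArg Strictify.mk (List.nil_append A.objs)
  tensor_unit A := congrArg Strictify.mk (List.append_nil A.objs)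
  tensor_assoc A B D := congrArg Strictify.mk (List.append_assoc A.objs B.objs D.objs)
  leftUnitor_eq _ := rfl
  rightUnitor_eq _ := rfl
  associator_eq _ _ _ := rfl

instance : (toBase C).Monoidal := Monoidal.fromInducedMonoidal (toBase C) inducingData

variable [SymmetricCategory C]

/-- The symmetry of the strictification, induced by the symmetry of the base. -/
def braidIso (A B : Strictify C) : A ⊗ B ≅ B ⊗ A where
  hom := ⟨(mergeIso A.objs B.objs).inv ≫ (β_ A.toObj B.toObj).hom ≫
    (mergeIso B.objs A.objs).hom⟩
  inv := ⟨(mergeIso B.objs A.objs).inv ≫ (β_ A.toObj B.toObj).inv ≫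
    (mergeIso A.objs B.objs).hom⟩
  hom_inv_id := by
    have h : ((mergeIso A.objs B.objs).inv ≫ (β_ A.toObj B.toObj).hom ≫
        (mergeIso B.objs A.objs).hom) ≫ (mergeIso B.objs A.objs).inv ≫ (β_ A.toObj B.toObj).inv ≫
          (mergeIso A.objs B.objs).hom = 𝟙 _ := by
      simp [toObj]
    exact Hom.ext h
  inv_hom_id := by
    have h : ((mergeIso B.objs A.objs).inv ≫ (β_ A.toObj B.toObj).inv ≫
        (mergeIso A.objs B.objs).hom) ≫ (mergeIso A.objs B.objs).inv ≫ (β_ A.toObj B.toObj).hom ≫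
          (mergeIso B.objs A.objs).hom = 𝟙 _ := by
      simp [toObj]
    exact Hom.ext h

theorem toBase_braid (A B : Strictify C) :
    (mergeIso A.objs B.objs).hom ≫ (mergeIso A.objs B.objs).inv ≫ (β_ A.toObj B.toObj).hom ≫
      (mergeIso B.objs A.objs).hom = (β_ A.toObj B.toObj).hom ≫ (mergeIso B.objs A.objs).hom :=
  Iso.hom_inv_id_assoc _ _

instance : BraidedCategory (Strictify C) :=
  BraidedCategory.ofFaithful (toBase C) braidIso (fun A B => by exact toBase_braid A B)

instance : (toBase C).Braided where
  braided A B := toBase_braid A B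

instance : SymmetricCategory (Strictify C) :=
  SymmetricCategory.ofFaithful (toBase C)

end Strictify

end Strictify

/-! ### Sets and partial functions -/

/-- The category of sets and partial functions: objects. -/
structure SetStar : Type (w + 1) where
  carrier : Type w

namespace SetStar

/-- Morphisms are partial functions. -/
@[ext]
structure Hom (A B : SetStar.{w}) : Type w where
  fn : A.carrier →. B.carrier

instance : Category.{w} SetStar.{w} where
  Hom A B := Hom A B
  id A := ⟨PFun.id A.carrier⟩
  comp f g := ⟨g.fn.comp f.fn⟩
  id_comp f := Hom.ext (PFun.comp_id f.fn)
  comp_id f := Hom.ext (PFun.id_comp f.fn)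
  assoc f g h := Hom.ext (PFun.comp_assoc h.fn g.fn f.fn).symm

theorem hom_ext {A B : SetStar.{w}} {f g : A ⟶ B}
    (h : ∀ a b, b ∈ f.fn a ↔ b ∈ g.fn a) : f = g :=
  Hom.ext (PFun.ext h)

@[simp]
theorem mem_comp {A B D : SetStar.{w}} (f : A ⟶ B) (g : B ⟶ D) (a : A.carrier)
    (d : D.carrier) : d ∈ (f ≫ g).fn a ↔ ∃ b, b ∈ f.fn a ∧ d ∈ g.fn b :=
  Part.mem_bind_iff

@[simp]
theorem mem_id (A : SetStar.{w}) (a b : A.carrier) : b ∈ (𝟙 A : A ⟶ A).fn a ↔ b = a :=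
  Part.mem_some_iff

/-- A bijection as an isomorphism in the category of partial functions. -/
def isoMk {A B : SetStar.{w}} (e : A.carrier ≃ B.carrier) : A ≅ B where
  hom := ⟨PFun.lift e⟩
  inv := ⟨PFun.lift e.symm⟩
  hom_inv_id := hom_ext (by simp)
  inv_hom_id := hom_ext (by simp)

@[simp]
theorem mem_isoMk_hom {A B : SetStar.{w}} (e : A.carrier ≃ B.carrier) (a : A.carrier)
    (b : B.carrier) : b ∈ (isoMk e).hom.fn a ↔ b = e a :=
  Part.mem_some_iff

@[simp]
theorem mem_isoMk_inv {A B : SetStar.{w}} (e : A.carrier ≃ B.carrier) (a : A.carrier)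
    (b : B.carrier) : a ∈ (isoMk e).inv.fn b ↔ a = e.symm b :=
  Part.mem_some_iff

/-- The monoidal structure is the cartesian product of sets. -/
instance : MonoidalCategoryStruct SetStar.{w} where
  tensorUnit := ⟨PUnit⟩
  tensorObj A B := ⟨A.carrier × B.carrier⟩
  tensorHom f g := ⟨f.fn.prodMap g.fn⟩
  whiskerLeft A _ _ g := ⟨(PFun.id A.carrier).prodMap g.fn⟩
  whiskerRight f B := ⟨f.fn.prodMap (PFun.id B.carrier)⟩
  associator A B D := isoMk (Equiv.prodAssoc A.carrier B.carrier D.carrier)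
  leftUnitor A := isoMk (Equiv.punitProd A.carrier)
  rightUnitor A := isoMk (Equiv.prodPUnit A.carrier)

theorem mem_tensor {A B A' B' : SetStar.{w}} (f : A ⟶ A') (g : B ⟶ B') (x : (A ⊗ B).carrier)
    (y : (A' ⊗ B').carrier) : y ∈ (f ⊗ₘ g).fn x ↔ y.1 ∈ f.fn x.1 ∧ y.2 ∈ g.fn x.2 :=
  PFun.mem_prodMap

theorem mem_whiskerLeft (A : SetStar.{w}) {B B' : SetStar.{w}} (g : B ⟶ B')
    (x : (A ⊗ B).carrier) (y : (A ⊗ B').carrier) :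
    y ∈ (A ◁ g).fn x ↔ y.1 = x.1 ∧ y.2 ∈ g.fn x.2 :=
  PFun.mem_prodMap.trans (and_congr_left' Part.mem_some_iff)

theorem mem_whiskerRight {A A' : SetStar.{w}} (f : A ⟶ A') (B : SetStar.{w})
    (x : (A ⊗ B).carrier) (y : (A' ⊗ B).carrier) :
    y ∈ (f ▷ B).fn x ↔ y.1 ∈ f.fn x.1 ∧ y.2 = x.2 :=
  PFun.mem_prodMap.trans (and_congr_right' Part.mem_some_iff)

theorem mem_associator (A B D : SetStar.{w}) (x : ((A ⊗ B) ⊗ D).carrier)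
    (y : (A ⊗ (B ⊗ D)).carrier) :
    y ∈ (α_ A B D).hom.fn x ↔ y.1 = x.1.1 ∧ y.2.1 = x.1.2 ∧ y.2.2 = x.2 := by
  refine (mem_isoMk_hom _ _ _).trans ?_
  obtain ⟨y1, y2, y3⟩ := y
  exact Prod.mk_inj.trans (and_congr_right' Prod.mk_inj)

theorem mem_leftUnitor (A : SetStar.{w}) (x : (𝟙_ SetStar.{w} ⊗ A).carrier) (y : A.carrier) :
    y ∈ (λ_ A).hom.fn x ↔ y = x.2 :=
  mem_isoMk_hom _ _ _

theorem mem_rightUnitor (A : SetStar.{w}) (x : (A ⊗ 𝟙_ SetStar.{w}).carrier) (y : A.carrier) :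
    y ∈ (ρ_ A).hom.fn x ↔ y = x.1 :=
  mem_isoMk_hom _ _ _

theorem exists_tensor {A B : SetStar.{w}} {p : (A ⊗ B).carrier → Prop} :
    (∃ x, p x) ↔ ∃ (a : A.carrier) (b : B.carrier), p (a, b) :=
  Prod.exists

instance : MonoidalCategory SetStar.{w} :=
  MonoidalCategory.ofTensorHom
    (id_tensorHom_id := fun A B => by
      apply hom_ext
      rintro ⟨a, b⟩ ⟨c, d⟩
      rw [mem_tensor, mem_id, mem_id, mem_id]
      exact Prod.mk_inj.symm)
    (id_tensorHom := fun _ _ _ _ => rfl)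
    (tensorHom_id := fun _ _ => rfl)
    (tensorHom_comp_tensorHom := fun f f' g g' => by
      apply hom_ext
      rintro ⟨a, b⟩ ⟨c, d⟩
      simp only [mem_comp, mem_tensor, exists_tensor]
      grind)
    (associator_naturality := fun f g h => by
      apply hom_ext
      rintro ⟨⟨a, b⟩, c⟩ ⟨a', b', c'⟩
      simp only [mem_comp, mem_tensor, exists_tensor, mem_associator]
      grind)
    (leftUnitor_naturality := fun f => by
      apply hom_ext
      rintro ⟨⟨⟩, a⟩ a'
      simp only [mem_comp, mem_tensor, exists_tensor, mem_leftUnitor, mem_id]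
      grind)
    (rightUnitor_naturality := fun f => by
      apply hom_ext
      rintro ⟨a, ⟨⟩⟩ a'
      simp only [mem_comp, mem_tensor, exists_tensor, mem_rightUnitor, mem_id]
      grind)
    (pentagon := fun A B D E => by
      apply hom_ext
      rintro ⟨⟨⟨a, b⟩, c⟩, d⟩ ⟨a', b', c', d'⟩
      simp only [mem_comp, mem_tensor, exists_tensor, mem_associator, mem_id]
      grind)
    (triangle := fun A B => by
      apply hom_ext
      rintro ⟨⟨a, ⟨⟩⟩, b⟩ ⟨a', b'⟩
      simp only [mem_comp, mem_tensor, exists_tensor, mem_associator, mem_leftUnitor,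
        mem_rightUnitor, mem_id]
      grind)

/-- The swap. -/
def braidIso (A B : SetStar.{w}) : A ⊗ B ≅ B ⊗ A :=
  isoMk (Equiv.prodComm A.carrier B.carrier)

theorem mem_braid (A B : SetStar.{w}) (x : (A ⊗ B).carrier) (y : (B ⊗ A).carrier) :
    y ∈ (braidIso A B).hom.fn x ↔ y.1 = x.2 ∧ y.2 = x.1 := by
  refine (mem_isoMk_hom _ _ _).trans ?_
  obtain ⟨y1, y2⟩ := y
  exact Prod.mk_inj

theorem mem_associator_inv (A B D : SetStar.{w}) (x : (A ⊗ (B ⊗ D)).carrier)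
    (y : ((A ⊗ B) ⊗ D).carrier) :
    y ∈ (α_ A B D).inv.fn x ↔ y.1.1 = x.1 ∧ y.1.2 = x.2.1 ∧ y.2 = x.2.2 := by
  refine (mem_isoMk_inv _ _ _).trans ?_
  obtain ⟨⟨y1, y2⟩, y3⟩ := y
  exact Prod.mk_inj.trans ((and_congr_left' Prod.mk_inj).trans and_assoc)

instance : BraidedCategory SetStar.{w} where
  braiding := braidIso
  braiding_naturality_right := by
    intro X Y Z f
    apply hom_ext
    rintro ⟨a, b⟩ ⟨c, d⟩
    simp only [mem_comp, mem_whiskerLeft, mem_whiskerRight, exists_tensor, mem_braid]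
    grind
  braiding_naturality_left := by
    intro X Y f Z
    apply hom_ext
    rintro ⟨a, b⟩ ⟨c, d⟩
    simp only [mem_comp, mem_whiskerLeft, mem_whiskerRight, exists_tensor, mem_braid]
    grind
  hexagon_forward := by
    intro X Y Z
    apply hom_ext
    rintro ⟨⟨a, b⟩, c⟩ ⟨a', b', c'⟩
    simp only [mem_comp, mem_whiskerLeft, mem_whiskerRight, exists_tensor, mem_braid,
      mem_associator]
    grind
  hexagon_reverse := by
    intro X Y Z
    apply hom_ext
    rintro ⟨a, b, c⟩ ⟨⟨a', b'⟩, c'⟩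
    simp only [mem_comp, mem_whiskerLeft, mem_whiskerRight, exists_tensor, mem_braid,
      mem_associator_inv]
    grind

instance : SymmetricCategory SetStar.{w} where
  symmetry A B := hom_ext (by
    rintro ⟨a, b⟩ ⟨c, d⟩
    refine (mem_comp _ _ _ _).trans (Iff.trans ?_ (mem_id _ _ _).symm)
    rw [exists_tensor]
    refine Iff.trans (exists_congr fun _ => exists_congr fun _ =>
      and_congr (mem_braid _ _ _ _) (mem_braid _ _ _ _)) ?_
    refine Iff.trans ?_ Prod.mk_inj.symm
    grind)

end SetStar

/-! ### Sets and spans -/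

/-- The category of sets and isomorphism classes of spans: objects. -/
structure SpanCat : Type (w + 1) where
  carrier : Type w

/-- A span of sets from `A` to `B`. -/
structure SetSpan (A B : Type w) : Type (w + 1) where
  apex : Type w
  left : apex → A
  right : apex → B

namespace SetSpan

/-- Two spans are isomorphic when a bijection of apexes commutes with the legs. -/
instance setoid (A B : Type w) : Setoid (SetSpan A B) where
  r S T := ∃ e : S.apex ≃ T.apex, (∀ s, T.left (e s) = S.left s) ∧ ∀ s, T.right (e s) = S.right s
  iseqv :=
    { refl := fun _ => ⟨Equiv.refl _, fun _ => rfl, fun _ => rfl⟩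
      symm := fun ⟨e, h, h'⟩ => ⟨e.symm, fun s => by simp [← h], fun s => by simp [← h']⟩
      trans := fun ⟨e, h, h'⟩ ⟨d, k, k'⟩ =>
        ⟨e.trans d, fun s => by simp [k, h], fun s => by simp [k', h']⟩ }

/-- The graph of a function. -/
def graph {A B : Type w} (f : A → B) : SetSpan A B := ⟨A, fun a => a, f⟩

/-- Composition of spans, by pullback. -/
def comp {A B D : Type w} (S : SetSpan A B) (T : SetSpan B D) : SetSpan A D where
  apex := {p : S.apex × T.apex // S.right p.1 = T.left p.2}
  left p := S.left p.1.1
  right p := T.right p.1.2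

/-- Product of spans. -/
def prod {A B A' B' : Type w} (S : SetSpan A A') (T : SetSpan B B') :
    SetSpan (A × B) (A' × B') where
  apex := S.apex × T.apex
  left := Prod.map S.left T.left
  right := Prod.map S.right T.right

theorem comp_congr {A B D : Type w} {S S' : SetSpan A B} {T T' : SetSpan B D} (hS : S ≈ S')
    (hT : T ≈ T') : comp S T ≈ comp S' T' := by
  obtain ⟨e, he, he'⟩ := hS
  obtain ⟨d, hd, hd'⟩ := hT
  exact ⟨(Equiv.prodCongr e d).subtypeEquiv (fun p => by simp [he', hd]),
    fun p => he _, fun p => hd' _⟩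

theorem prod_congr {A B A' B' : Type w} {S S' : SetSpan A A'} {T T' : SetSpan B B'}
    (hS : S ≈ S') (hT : T ≈ T') : prod S T ≈ prod S' T' := by
  obtain ⟨e, he, he'⟩ := hS
  obtain ⟨d, hd, hd'⟩ := hT
  exact ⟨Equiv.prodCongr e d, fun p => Prod.ext (he _) (hd _),
    fun p => Prod.ext (he' _) (hd' _)⟩

theorem comp_graph {A B D : Type w} (S : SetSpan A B) (f : B → D) :
    comp S (graph f) ≈ ⟨S.apex, S.left, fun s => f (S.right s)⟩ :=
  ⟨⟨fun p => p.1.1, fun s => ⟨(s, S.right s), rfl⟩,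
    fun ⟨⟨_, _⟩, h⟩ => Subtype.ext (Prod.ext rfl h), fun _ => rfl⟩,
    fun _ => rfl, fun p => congrArg f p.2⟩

theorem graph_comp {A B D : Type w} (e : A ≃ B) (T : SetSpan B D) :
    comp (graph e) T ≈ ⟨T.apex, fun t => e.symm (T.left t), T.right⟩ :=
  ⟨⟨fun p => p.1.2, fun t => ⟨(e.symm (T.left t), t), e.apply_symm_apply _⟩,
    fun ⟨⟨_, _⟩, h⟩ => Subtype.ext (Prod.ext ((Equiv.symm_apply_eq e).2 h.symm) rfl),
    fun _ => rfl⟩,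
    fun p => (Equiv.symm_apply_eq e).2 p.2.symm, fun _ => rfl⟩

theorem graph_comp_graph {A B D : Type w} (f : A → B) (g : B → D) :
    comp (graph f) (graph g) ≈ graph (fun a => g (f a)) :=
  comp_graph (graph f) g

theorem comp_assoc {A B D E : Type w} (S : SetSpan A B) (T : SetSpan B D) (U : SetSpan D E) :
    comp (comp S T) U ≈ comp S (comp T U) :=
  ⟨⟨fun p => ⟨(p.1.1.1.1, ⟨(p.1.1.1.2, p.1.2), p.2⟩), p.1.1.2⟩,
    fun p => ⟨(⟨(p.1.1, p.1.2.1.1), p.2⟩, p.1.2.1.2), p.1.2.2⟩,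
    fun _ => rfl, fun _ => rfl⟩, fun _ => rfl, fun _ => rfl⟩

theorem prod_comp_prod {A B D A' B' D' : Type w} (S : SetSpan A B) (T : SetSpan B D)
    (S' : SetSpan A' B') (T' : SetSpan B' D') :
    comp (prod S S') (prod T T') ≈ prod (comp S T) (comp S' T') :=
  ⟨⟨fun p => (⟨(p.1.1.1, p.1.2.1), congrArg Prod.fst p.2⟩,
      ⟨(p.1.1.2, p.1.2.2), congrArg Prod.snd p.2⟩),
    fun p => ⟨((p.1.1.1, p.2.1.1), (p.1.1.2, p.2.1.2)), Prod.ext p.1.2 p.2.2⟩,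
    fun _ => rfl, fun _ => rfl⟩, fun _ => rfl, fun _ => rfl⟩

end SetSpan

namespace SpanCat

/-- Morphisms are spans up to isomorphism. -/
@[ext]
structure Hom (A B : SpanCat.{w}) : Type (w + 1) where
  cls : Quotient (SetSpan.setoid A.carrier B.carrier)

/-- The class of a span. -/
def Hom.mk' {A B : SpanCat.{w}} (S : SetSpan A.carrier B.carrier) : Hom A B := ⟨⟦S⟧⟩

theorem Hom.sound {A B : SpanCat.{w}} {S T : SetSpan A.carrier B.carrier} (h : S ≈ T) :
    Hom.mk' S = Hom.mk' T :=
  Hom.ext (Quotient.sound h)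

theorem Hom.ind {A B : SpanCat.{w}} {p : Hom A B → Prop}
    (h : ∀ S : SetSpan A.carrier B.carrier, p (Hom.mk' S)) (f : Hom A B) : p f := by
  obtain ⟨f⟩ := f
  induction f using Quotient.ind with
  | _ S => exact h S

instance : Category.{w + 1} SpanCat.{w} where
  Hom A B := Hom A B
  id A := Hom.mk' (SetSpan.graph fun a => a)
  comp f g := ⟨Quotient.map₂ SetSpan.comp (fun _ _ hf _ _ hg => SetSpan.comp_congr hf hg)
    f.cls g.cls⟩
  id_comp f := by
    induction f using Hom.ind with
    | h S => exact Hom.sound (SetSpan.graph_comp (Equiv.refl _) S)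
  comp_id f := by
    induction f using Hom.ind with
    | h S => exact Hom.sound (SetSpan.comp_graph S fun a => a)
  assoc f g h := by
    induction f using Hom.ind with
    | h S =>
      induction g using Hom.ind with
      | h T =>
        induction h using Hom.ind with
        | h U => exact Hom.sound (SetSpan.comp_assoc S T U)

/-- The morphism represented by a span. -/
def homMk {A B : SpanCat.{w}} (S : SetSpan A.carrier B.carrier) : A ⟶ B := Hom.mk' S

theorem mk_eq {A B : SpanCat.{w}} {S T : SetSpan A.carrier B.carrier} (h : S ≈ T) :
    (homMk S : A ⟶ B) = homMk T :=
  Hom.sound h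

theorem mk_surj {A B : SpanCat.{w}} (f : A ⟶ B) : ∃ S, f = homMk S := by
  induction f using Hom.ind with
  | h S => exact ⟨S, rfl⟩

theorem mk_comp {A B D : SpanCat.{w}} (S : SetSpan A.carrier B.carrier)
    (T : SetSpan B.carrier D.carrier) : (homMk S : A ⟶ B) ≫ (homMk T : B ⟶ D) = homMk (S.comp T) :=
  rfl

/-- A function as a span. -/
def ofFun {A B : SpanCat.{w}} (f : A.carrier → B.carrier) : A ⟶ B := homMk (SetSpan.graph f)

theorem ofFun_comp {A B D : SpanCat.{w}} (f : A.carrier → B.carrier)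
    (g : B.carrier → D.carrier) :
    (ofFun f : A ⟶ B) ≫ (ofFun g : B ⟶ D) = ofFun (fun a => g (f a)) :=
  mk_eq (SetSpan.graph_comp_graph f g)

theorem ofFun_id (A : SpanCat.{w}) : (ofFun fun a => a : A ⟶ A) = 𝟙 A := rfl

/-- A bijection as an isomorphism in the category of spans. -/
def isoMk {A B : SpanCat.{w}} (e : A.carrier ≃ B.carrier) : A ≅ B where
  hom := ofFun e
  inv := ofFun e.symm
  hom_inv_id := by simp [ofFun_comp, ofFun_id]
  inv_hom_id := by simp [ofFun_comp, ofFun_id]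

/-- Product of morphisms. -/
def prodHom {A B A' B' : SpanCat.{w}} (f : A ⟶ A') (g : B ⟶ B') :
    (⟨A.carrier × B.carrier⟩ : SpanCat.{w}) ⟶ ⟨A'.carrier × B'.carrier⟩ :=
  Hom.mk (Quotient.map₂ SetSpan.prod (fun _ _ hf _ _ hg => SetSpan.prod_congr hf hg) f.cls g.cls)

/-- The monoidal structure is the cartesian product of sets. -/
instance : MonoidalCategoryStruct SpanCat.{w} where
  tensorUnit := ⟨PUnit⟩
  tensorObj A B := ⟨A.carrier × B.carrier⟩
  tensorHom f g := prodHom f g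
  whiskerLeft A _ _ g := prodHom (𝟙 A) g
  whiskerRight f B := prodHom f (𝟙 B)
  associator A B D := isoMk (Equiv.prodAssoc A.carrier B.carrier D.carrier)
  leftUnitor A := isoMk (Equiv.punitProd A.carrier)
  rightUnitor A := isoMk (Equiv.prodPUnit A.carrier)

theorem mk_tensor {A B A' B' : SpanCat.{w}} (S : SetSpan A.carrier A'.carrier)
    (T : SetSpan B.carrier B'.carrier) :
    (homMk S : A ⟶ A') ⊗ₘ (homMk T : B ⟶ B') = homMk (S.prod T) :=
  rfl

theorem ofFun_tensor {A B A' B' : SpanCat.{w}} (f : A.carrier → A'.carrier)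
    (g : B.carrier → B'.carrier) :
    (ofFun f : A ⟶ A') ⊗ₘ (ofFun g : B ⟶ B') = ofFun (Prod.map f g) :=
  rfl

instance : MonoidalCategory SpanCat.{w} :=
  MonoidalCategory.ofTensorHom
    (id_tensorHom_id := fun _ _ => rfl)
    (id_tensorHom := fun _ _ _ _ => rfl)
    (tensorHom_id := fun _ _ => rfl)
    (tensorHom_comp_tensorHom := fun f f' g g' => by
      obtain ⟨S, rfl⟩ := mk_surj f
      obtain ⟨S', rfl⟩ := mk_surj f'
      obtain ⟨T, rfl⟩ := mk_surj g
      obtain ⟨T', rfl⟩ := mk_surj g'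
      exact mk_eq (SetSpan.prod_comp_prod S T S' T'))
    (associator_naturality := fun f g h => by
      obtain ⟨S, rfl⟩ := mk_surj f
      obtain ⟨T, rfl⟩ := mk_surj g
      obtain ⟨U, rfl⟩ := mk_surj h
      refine (mk_eq (SetSpan.comp_graph _ _)).trans (Eq.trans ?_
        (mk_eq (SetSpan.graph_comp (Equiv.prodAssoc _ _ _) _)).symm)
      exact mk_eq ⟨Equiv.prodAssoc _ _ _, fun _ => rfl, fun _ => rfl⟩)
    (leftUnitor_naturality := fun f => by
      obtain ⟨S, rfl⟩ := mk_surj f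
      refine (mk_eq (SetSpan.comp_graph _ _)).trans (Eq.trans ?_
        (mk_eq (SetSpan.graph_comp (Equiv.punitProd _) _)).symm)
      exact mk_eq ⟨Equiv.punitProd _, fun _ => rfl, fun _ => rfl⟩)
    (rightUnitor_naturality := fun f => by
      obtain ⟨S, rfl⟩ := mk_surj f
      refine (mk_eq (SetSpan.comp_graph _ _)).trans (Eq.trans ?_
        (mk_eq (SetSpan.graph_comp (Equiv.prodPUnit _) _)).symm)
      exact mk_eq ⟨Equiv.prodPUnit _, fun _ => rfl, fun _ => rfl⟩)
    (pentagon := fun A B D E => by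
      simp only [← ofFun_id, isoMk, MonoidalCategoryStruct.associator]
      rw [ofFun_tensor, ofFun_tensor]
      erw [ofFun_comp, ofFun_comp, ofFun_comp]
      rfl)
    (triangle := fun A B => by
      simp only [← ofFun_id, isoMk, MonoidalCategoryStruct.associator,
        MonoidalCategoryStruct.leftUnitor, MonoidalCategoryStruct.rightUnitor]
      rw [ofFun_tensor, ofFun_tensor]
      erw [ofFun_comp]
      rfl)

/-- The swap. -/
def braidIso (A B : SpanCat.{w}) : A ⊗ B ≅ B ⊗ A :=
  isoMk (Equiv.prodComm A.carrier B.carrier)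

theorem braid_naturality {A B A' B' : SpanCat.{w}} (f : A ⟶ A') (g : B ⟶ B') :
    (f ⊗ₘ g) ≫ (braidIso A' B').hom = (braidIso A B).hom ≫ (g ⊗ₘ f) := by
  obtain ⟨S, rfl⟩ := mk_surj f
  obtain ⟨T, rfl⟩ := mk_surj g
  refine (mk_eq (SetSpan.comp_graph _ _)).trans (Eq.trans ?_
    (mk_eq (SetSpan.graph_comp (Equiv.prodComm _ _) _)).symm)
  exact mk_eq ⟨Equiv.prodComm _ _, fun _ => rfl, fun _ => rfl⟩

instance : BraidedCategory SpanCat.{w} where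
  braiding := braidIso
  braiding_naturality_right _ _ _ f := braid_naturality (𝟙 _) f
  braiding_naturality_left f Z := braid_naturality f (𝟙 Z)
  hexagon_forward := by
    intro X Y Z
    rw [← tensorHom_id, ← id_tensorHom]
    simp only [← ofFun_id, isoMk, braidIso, MonoidalCategoryStruct.associator]
    rw [ofFun_tensor, ofFun_tensor]
    erw [ofFun_comp, ofFun_comp, ofFun_comp, ofFun_comp]
    rfl
  hexagon_reverse := by
    intro X Y Z
    rw [← tensorHom_id, ← id_tensorHom]
    simp only [← ofFun_id, isoMk, braidIso, MonoidalCategoryStruct.associator]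
    rw [ofFun_tensor, ofFun_tensor]
    erw [ofFun_comp, ofFun_comp, ofFun_comp, ofFun_comp]
    rfl

instance : SymmetricCategory SpanCat.{w} where
  symmetry A B := (isoMk (A := A ⊗ B) (B := B ⊗ A)
    (Equiv.prodComm A.carrier B.carrier)).hom_inv_id

end SpanCat

/-! ### Guarded nets, markings and reachability -/

/-- What is read off a semantics category whose objects are sets and whose tensor product is the
cartesian product: the elements of an object, and, for a morphism `f`, the ways in which `f`
leads from an element `a` to an element `b`. -/
class Semantics (S : Type u) [Category.{v} S] [MonoidalCategory S] where
  El : S → Type w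
  unitEl : El (𝟙_ S)
  pairEquiv (A B : S) : El (A ⊗ B) ≃ El A × El B
  Path {A B : S} (f : A ⟶ B) (a : El A) (b : El B) : Type w

/-- For a partial function there is one way from `a` to `b` if `f a` is defined and equals `b`,
and none otherwise. -/
instance : Semantics.{w + 1, w, w} SetStar.{w} where
  El A := A.carrier
  unitEl := PUnit.unit
  pairEquiv A B := Equiv.refl (A.carrier × B.carrier)
  Path f a b := ULift.{w} (PLift (b ∈ f.fn a))

/-- A span representing a morphism of the category of spans. -/
noncomputable def SpanCat.rep {A B : SpanCat.{w}} (f : A ⟶ B) : SetSpan A.carrier B.carrier :=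
  Quotient.out f.cls

/-- For a span, the ways from `a` to `b` are the elements of the apex lying over `(a, b)`. -/
noncomputable instance : Semantics.{w + 1, w + 1, w} SpanCat.{w} where
  El A := A.carrier
  unitEl := PUnit.unit
  pairEquiv A B := Equiv.refl (A.carrier × B.carrier)
  Path f a b := {s : (SpanCat.rep f).apex //
    (SpanCat.rep f).left s = a ∧ (SpanCat.rep f).right s = b}

universe uP uT uS vS

/-- An element of a product of a concatenated list splits into its two parts. -/
def splitEl {S : Type uS} [Category.{vS} S] [MonoidalCategory S] [Semantics.{uS, vS, w} S] :
    (A B : List S) → Semantics.El (tensorList (A ++ B)) →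
      Semantics.El (tensorList A) × Semantics.El (tensorList B)
  | [], _, x => (Semantics.unitEl, x)
  | X :: A, B, x =>
    let p := Semantics.pairEquiv X (tensorList (A ++ B)) x
    let q := splitEl A B p.2
    ((Semantics.pairEquiv X (tensorList A)).symm (p.1, q.1), q.2)

/-- A guarded net with semantics in (the strictification of) `S`: a Petri net and a strict
symmetric monoidal functor from its free symmetric strict monoidal category. -/
structure GuardedNet (S : Type uS) [Category.{vS} S] [MonoidalCategory S]
    [SymmetricCategory S] where
  net : PetriNet.{uP, uT}
  ord : net.Ordering
  sem : StrictSymmetricFunctor (Free ord) (Strictify S)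

namespace GuardedNet

variable {S : Type uS} [Category.{vS} S] [MonoidalCategory S] [SymmetricCategory S]
  [Semantics.{uS, vS, w} S] (G : GuardedNet.{uP, uT, uS, vS} S)

/-- The set assigned by the semantics to an object of the free category. -/
def El (X : Free G.ord) : Type w := Semantics.El (G.sem.obj X).toObj

/-- A marking `(X, x)`. Markings are also the objects of the internalization. -/
structure Marking where
  obj : Free G.ord
  elt : G.El obj

variable {G} in
/-- A morphism `(X, x) ⟶ (Y, y)` of the internalization: a morphism `X ⟶ Y` of the free category
with a way from `x` to `y` along its image under the semantics. -/
structure Marking.Hom (A B : G.Marking) where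
  base : A.obj ⟶ B.obj
  path : Semantics.Path (G.sem.map base).val A.elt B.elt

/-- The objects and morphisms of the internalization. -/
instance : Quiver G.Marking where
  Hom A B := Marking.Hom A B

/-- Reachability in the guarded net: some morphism of the free category sends `x` to `y`. -/
def Reachable (A B : G.Marking) : Prop :=
  ∃ f : A.obj ⟶ B.obj, Nonempty (Semantics.Path (G.sem.map f).val A.elt B.elt)

/-- An element over a string of places splits off the colour of the first token. -/
def splitFirst (p : G.net.Place) (X : List G.net.Place) (x : G.El ⟨p :: X⟩) :
    G.El ⟨[p]⟩ × G.El ⟨X⟩ :=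
  splitEl (G.sem.obj ⟨[p]⟩).objs (G.sem.obj ⟨X⟩).objs
    (cast (congrArg (fun A : Strictify S => Semantics.El A.toObj)
      (G.sem.obj_tensor ⟨[p]⟩ ⟨X⟩)) x)

/-- A generating object of the internalization: a place together with a colour. -/
abbrev ColouredPlace := (p : G.net.Place) × G.El ⟨[p]⟩

/-- The decomposition of an object `(X, x)` of the internalization as a tensor product of
generating objects. -/
def tokens : (X : List G.net.Place) → G.El ⟨X⟩ → List G.ColouredPlace
  | [], _ => []
  | p :: X, x => ⟨p, (G.splitFirst p X x).1⟩ :: tokens X (G.splitFirst p X x).2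

/-- A generating morphism of the internalization: a morphism lying over a generating morphism of
the free category. -/
structure GeneratingHom where
  trans : G.net.Trans
  source : G.El ⟨G.ord.src trans⟩
  target : G.El ⟨G.ord.tgt trans⟩
  hom : (⟨⟨G.ord.src trans⟩, source⟩ : G.Marking) ⟶ ⟨⟨G.ord.tgt trans⟩, target⟩
  base_eq : hom.base = Free.gen G.ord trans

/-- The Petri net underlying the internalization: its places are the generating objects, its
transitions the generating morphisms. -/
def internalNet : PetriNet.{max uP w, max uP uT w} where
  Place := G.ColouredPlace
  Trans := G.GeneratingHom
  input τ := G.tokens (G.ord.src τ.trans) τ.source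
  output τ := G.tokens (G.ord.tgt τ.trans) τ.target

variable {G} in
/-- The marking of the underlying net of the internalization that corresponds to `(X, x)`. -/
def Marking.toInternal (o : G.internalNet.Ordering) (A : G.Marking) : Free o :=
  ⟨G.tokens A.obj.word A.elt⟩

end GuardedNet

/-- Reachability in an unguarded net: existence of a morphism of the free category. -/
def NetReachable {N : PetriNet.{u, v}} (o : N.Ordering) (X Y : Free o) : Prop :=
  Nonempty (X ⟶ Y)

theorem GuardedNet.Marking.hom_ext {G : GuardedNet.{uP, uT} SetStar.{w}} {A B : G.Marking}
    {f g : GuardedNet.Marking.Hom A B} (h : f.base = g.base) : f = g := by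
  obtain ⟨f, ⟨⟨p⟩⟩⟩ := f
  obtain ⟨g, ⟨⟨q⟩⟩⟩ := g
  cases h
  rfl

/-- For partial functions, the internalization is a category, with composition inherited from the
free category of the net. -/
instance (G : GuardedNet.{uP, uT} SetStar.{w}) : Category G.Marking where
  id A := ⟨𝟙 A.obj, by
    rw [G.sem.map_id]
    exact ⟨⟨(SetStar.mem_id _ _ _).2 rfl⟩⟩⟩
  comp {A B D} f g := ⟨f.base ≫ g.base, by
    rw [G.sem.map_comp]
    exact ⟨⟨(SetStar.mem_comp (G.sem.map f.base).val (G.sem.map g.base).val _ _).2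
      ⟨B.elt, f.path.down.down, g.path.down.down⟩⟩⟩⟩
  id_comp f := GuardedNet.Marking.hom_ext (Category.id_comp f.base)
  comp_id f := GuardedNet.Marking.hom_ext (Category.comp_id f.base)
  assoc f g h := GuardedNet.Marking.hom_ext (Category.assoc f.base g.base h.base)

end GuardedNets

/-! Reachability only asks whether a morphism exists, so the proof forgets everything about a
morphism `f` of the semantics category except the relation "some way leads from `a` to `b` along
`f`". For partial functions this relation is the graph. For spans it is the image of the apex, which
depends only on the isomorphism class. In both cases the passage to relations respects identities,
composition, products, structure maps and symmetries (`LawfulSemantics`), so both halves of the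
theorem are instances of `GuardedNet.reachable_iff_netReachable`.

Strictness of the semantics means that an element over a concatenation is the same as a pair of
elements over the parts. Iterating this, a marking is the same as a string of coloured places:
`tokens` is a bijection (`tokens_injective`, `exists_tokens_eq`) that turns splitting into
concatenation (`tokens_split`).

Both directions are then inductions on formal morphisms. A term of the guarded net, together with a
related pair of elements, lifts to a term of the internal net (`nonempty_internal_term`): a
composite supplies an intermediate marking, a tensor product splits, and a transition with a way
through it is by definition a transition of the internal net. Conversely each term constructor of
the internal net preserves reachability of markings (`TokensReachable.of_term`). No congruence axiom
has to be checked, because only existence is claimed. An ordering of the internal net may list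
inputs and outputs differently from `tokens`; symmetries repair this, since they realize every
permutation. -/

namespace GuardedNets

/-! ### Semantics as relations between elements. -/

section Lawful

/-- Some way leads from `a` to `b` along `f`. -/
def Rel {S : Type u} [Category.{v} S] [MonoidalCategory S] [Semantics.{u, v, w} S] {A B : S}
    (f : A ⟶ B) (a : Semantics.El A) (b : Semantics.El B) : Prop :=
  Nonempty (Semantics.Path f a b)

/-- The relation `Rel` is functorial, and monoidal with respect to the cartesian product. -/
class LawfulSemantics (S : Type u) [Category.{v} S] [MonoidalCategory S] [SymmetricCategory S]
    [Semantics.{u, v, w} S] : Prop where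
  unit_eq (x : Semantics.El (𝟙_ S)) : x = Semantics.unitEl
  rel_id {A : S} (a b : Semantics.El A) : Rel (𝟙 A) a b ↔ a = b
  rel_comp {A B D : S} (f : A ⟶ B) (g : B ⟶ D) (a : Semantics.El A) (d : Semantics.El D) :
    Rel (f ≫ g) a d ↔ ∃ b, Rel f a b ∧ Rel g b d
  rel_tensor {A A' B B' : S} (f : A ⟶ A') (g : B ⟶ B') (x : Semantics.El (A ⊗ B))
    (y : Semantics.El (A' ⊗ B')) :
    Rel (f ⊗ₘ g) x y ↔
      Rel f (Semantics.pairEquiv A B x).1 (Semantics.pairEquiv A' B' y).1 ∧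
        Rel g (Semantics.pairEquiv A B x).2 (Semantics.pairEquiv A' B' y).2
  rel_leftUnitor {A : S} (x : Semantics.El (𝟙_ S ⊗ A)) (y : Semantics.El A) :
    Rel (λ_ A).hom x y ↔ (Semantics.pairEquiv _ _ x).2 = y
  rel_associator {A B D : S} (x : Semantics.El ((A ⊗ B) ⊗ D))
    (y : Semantics.El (A ⊗ (B ⊗ D))) :
    Rel (α_ A B D).hom x y ↔
      (Semantics.pairEquiv _ _ (Semantics.pairEquiv _ _ x).1).1 = (Semantics.pairEquiv _ _ y).1 ∧
      (Semantics.pairEquiv _ _ (Semantics.pairEquiv _ _ x).1).2 =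
        (Semantics.pairEquiv _ _ (Semantics.pairEquiv _ _ y).2).1 ∧
      (Semantics.pairEquiv _ _ x).2 = (Semantics.pairEquiv _ _ (Semantics.pairEquiv _ _ y).2).2
  rel_braiding {A B : S} (x : Semantics.El (A ⊗ B)) (y : Semantics.El (B ⊗ A)) :
    Rel (β_ A B).hom x y ↔ (Semantics.pairEquiv A B x).1 = (Semantics.pairEquiv B A y).2 ∧
      (Semantics.pairEquiv A B x).2 = (Semantics.pairEquiv B A y).1

end Lawful

/-! ### Partial functions as relations. -/

namespace SetStar

theorem rel_iff {A B : SetStar.{w}} (f : A ⟶ B) (a : A.carrier) (b : B.carrier) :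
    Rel f a b ↔ b ∈ f.fn a :=
  ⟨fun ⟨⟨⟨h⟩⟩⟩ => h, fun h => ⟨⟨⟨h⟩⟩⟩⟩

instance : LawfulSemantics SetStar.{w} where
  unit_eq _ := rfl
  rel_id a b := (rel_iff _ a b).trans ((mem_id _ _ _).trans eq_comm)
  rel_comp f g a d := by
    refine (rel_iff _ a d).trans ((mem_comp f g a d).trans ?_)
    exact exists_congr fun b => and_congr (rel_iff f a b).symm (rel_iff g b d).symm
  rel_tensor f g x y := by
    refine (rel_iff _ x y).trans ((mem_tensor f g x y).trans ?_)
    exact and_congr (rel_iff _ _ _).symm (rel_iff _ _ _).symm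
  rel_leftUnitor x y := (rel_iff _ x y).trans ((mem_leftUnitor _ x y).trans eq_comm)
  rel_associator x y := by
    refine (rel_iff _ x y).trans ((mem_associator _ _ _ x y).trans ?_)
    exact and_congr eq_comm (and_congr eq_comm eq_comm)
  rel_braiding x y := by
    refine (rel_iff _ x y).trans ((mem_braid _ _ x y).trans (and_comm.trans ?_))
    exact and_congr eq_comm eq_comm

end SetStar

/-! ### Spans as relations. -/

namespace SpanCat

/-- `Path` is defined through a representative chosen by `Quotient.out`. An isomorphism of spans
carries apex elements over `(a, b)` to apex elements over `(a, b)`, so any representative may be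
used to test whether one exists. -/
theorem rel_homMk {A B : SpanCat.{w}} (T : SetSpan A.carrier B.carrier) (a : A.carrier)
    (b : B.carrier) : Rel (homMk T : A ⟶ B) a b ↔ ∃ s, T.left s = a ∧ T.right s = b := by
  have h : rep (homMk T : A ⟶ B) ≈ T := Quotient.exact (Quotient.out_eq _)
  obtain ⟨e, h₁, h₂⟩ := h
  constructor
  · rintro ⟨⟨s, hs, hs'⟩⟩
    exact ⟨e s, (h₁ s).trans hs, (h₂ s).trans hs'⟩
  · rintro ⟨s, hs, hs'⟩
    refine ⟨⟨e.symm s, ?_, ?_⟩⟩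
    · rw [← h₁, e.apply_symm_apply, hs]
    · rw [← h₂, e.apply_symm_apply, hs']

theorem rel_ofFun {A B : SpanCat.{w}} (f : A.carrier → B.carrier) (a : A.carrier)
    (b : B.carrier) : Rel (ofFun f : A ⟶ B) a b ↔ f a = b := by
  refine (rel_homMk _ a b).trans ⟨?_, fun h => ⟨a, rfl, h⟩⟩
  rintro ⟨s, rfl, h⟩
  exact h

/-- A point of the pullback is a matching pair of apex points, and their common foot is the
intermediate element of the relational composite. All structure maps are graphs of bijections. -/
instance : LawfulSemantics SpanCat.{w} where
  unit_eq _ := rfl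
  rel_id a b := rel_ofFun (fun a => a) a b
  rel_comp f g a d := by
    obtain ⟨T, rfl⟩ := mk_surj f
    obtain ⟨U, rfl⟩ := mk_surj g
    refine (rel_homMk (T.comp U) a d).trans ?_
    constructor
    · rintro ⟨⟨⟨s, t⟩, h⟩, h₁, h₂⟩
      exact ⟨T.right s, (rel_homMk T _ _).2 ⟨s, h₁, rfl⟩, (rel_homMk U _ _).2 ⟨t, h.symm, h₂⟩⟩
    · rintro ⟨b, hf, hg⟩
      obtain ⟨s, hs, hs'⟩ := (rel_homMk T _ _).1 hf
      obtain ⟨t, ht, ht'⟩ := (rel_homMk U _ _).1 hg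
      exact ⟨⟨(s, t), hs'.trans ht.symm⟩, hs, ht'⟩
  rel_tensor f g x y := by
    obtain ⟨T, rfl⟩ := mk_surj f
    obtain ⟨U, rfl⟩ := mk_surj g
    refine (rel_homMk (T.prod U) x y).trans ?_
    constructor
    · rintro ⟨⟨s, t⟩, rfl, rfl⟩
      exact ⟨(rel_homMk T _ _).2 ⟨s, rfl, rfl⟩, (rel_homMk U _ _).2 ⟨t, rfl, rfl⟩⟩
    · rintro ⟨hf, hg⟩
      obtain ⟨s, hs, hs'⟩ := (rel_homMk T _ _).1 hf
      obtain ⟨t, ht, ht'⟩ := (rel_homMk U _ _).1 hg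
      exact ⟨(s, t), Prod.ext hs ht, Prod.ext hs' ht'⟩
  rel_leftUnitor x y := rel_ofFun _ x y
  rel_associator {A B D} x y := by
    refine (rel_ofFun (A := (A ⊗ B) ⊗ D) (B := A ⊗ (B ⊗ D))
      (Equiv.prodAssoc A.carrier B.carrier D.carrier) x y).trans ?_
    exact Prod.ext_iff.trans (and_congr_right' Prod.ext_iff)
  rel_braiding {A B} x y := by
    refine (rel_ofFun (A := A ⊗ B) (B := B ⊗ A)
      (Equiv.prodComm A.carrier B.carrier) x y).trans ?_
    exact Prod.ext_iff.trans and_comm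

end SpanCat

/-! ### Elements of products of lists of sets. -/

section Lists

variable {S : Type u} [Category.{v} S] [MonoidalCategory S] [Semantics.{u, v, w} S]

/-- The relations of `e.hom` and `e.inv` compose to equality both ways. Hence each is total, and any
value it takes is forced, so the two are converse to each other. -/
theorem rel_inv [SymmetricCategory S] [LawfulSemantics.{u, v, w} S] {A B : S}
    (e : A ≅ B) (a : Semantics.El A)
    (b : Semantics.El B) :
    Rel e.inv b a ↔ Rel e.hom a b := by
  have h₁ : ∀ a a', (∃ b, Rel e.hom a b ∧ Rel e.inv b a') ↔ a = a' := fun a a' => by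
    rw [← LawfulSemantics.rel_comp, e.hom_inv_id, LawfulSemantics.rel_id]
  have h₂ : ∀ b b', (∃ a, Rel e.inv b a ∧ Rel e.hom a b') ↔ b = b' := fun b b' => by
    rw [← LawfulSemantics.rel_comp, e.inv_hom_id, LawfulSemantics.rel_id]
  constructor
  · intro h
    obtain ⟨b', hb, -⟩ := (h₁ a a).2 rfl
    obtain rfl := (h₂ b b').1 ⟨a, h, hb⟩
    exact hb
  · intro h
    obtain ⟨a', ha, -⟩ := (h₂ b b).2 rfl
    obtain rfl := (h₁ a a').1 ⟨b, h, ha⟩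
    exact ha

/-- This ties the categorical comparison isomorphism to the concrete `splitEl`. Both recurse on the
first list, one with unitor and associator, the other with `pairEquiv`. -/
theorem rel_mergeIso [SymmetricCategory S] [LawfulSemantics.{u, v, w} S] (A B : List S)
    (x : Semantics.El (tensorList A ⊗ tensorList B)) (y : Semantics.El (tensorList (A ++ B))) :
    Rel (mergeIso A B).hom x y ↔ Semantics.pairEquiv _ _ x = splitEl A B y := by
  induction A with
  | nil =>
    refine (LawfulSemantics.rel_leftUnitor (A := tensorList B) x y).trans
      (Iff.trans ?_ Prod.ext_iff.symm)
    exact (and_iff_right (LawfulSemantics.unit_eq (S := S) _)).symm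
  | cons X A ih =>
    have e : (mergeIso (X :: A) B).hom =
        (α_ X (tensorList A) (tensorList B)).hom ≫ (𝟙 X ⊗ₘ (mergeIso A B).hom) := by
      rw [id_tensorHom]; rfl
    rw [e]
    refine (LawfulSemantics.rel_comp _ _ x y).trans ?_
    have e' : splitEl (X :: A) B y =
        ((Semantics.pairEquiv X (tensorList A)).symm
          ((Semantics.pairEquiv X (tensorList (A ++ B)) y).1,
            (splitEl A B (Semantics.pairEquiv X (tensorList (A ++ B)) y).2).1),
          (splitEl A B (Semantics.pairEquiv X (tensorList (A ++ B)) y).2).2) := rfl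
    rw [e']
    refine Iff.trans ?_ Prod.ext_iff.symm
    constructor
    · rintro ⟨z, h₁, h₂⟩
      replace h₁ := (LawfulSemantics.rel_associator (A := X) x z).1 h₁
      replace h₂ := (LawfulSemantics.rel_tensor _ _ z y).1 h₂
      rw [LawfulSemantics.rel_id, ih] at h₂
      obtain ⟨h₁, h₃, h₄⟩ := h₁
      obtain ⟨h₅, h₆⟩ := h₂
      refine ⟨(Equiv.eq_symm_apply _).2 (Prod.ext (h₁.trans h₅) ?_), ?_⟩
      · exact h₃.trans (congrArg Prod.fst h₆)
      · exact h₄.trans (congrArg Prod.snd h₆)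
    · rintro ⟨h₁, h₂⟩
      replace h₁ := (Equiv.eq_symm_apply _).1 h₁
      -- The intermediate element is the rebracketed triple: the head of `y`, then the two halves of
      -- its tail.
      refine ⟨(Semantics.pairEquiv _ _).symm
        ((Semantics.pairEquiv X (tensorList (A ++ B)) y).1, (Semantics.pairEquiv _ _).symm
          (splitEl A B (Semantics.pairEquiv X (tensorList (A ++ B)) y).2)), ?_, ?_⟩
      · refine (LawfulSemantics.rel_associator (A := X) x _).2 ?_
        simp only [Equiv.apply_symm_apply]
        exact ⟨congrArg Prod.fst h₁, congrArg Prod.snd h₁, h₂⟩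
      · refine (LawfulSemantics.rel_tensor _ _ _ y).2 ?_
        rw [LawfulSemantics.rel_id, ih]
        simp only [Equiv.apply_symm_apply]
        exact ⟨rfl, rfl⟩

/-- The components of an element of a product. -/
def components : (L : List S) → Semantics.El (tensorList L) → List ((A : S) × Semantics.El A)
  | [], _ => []
  | A :: L, x => ⟨A, (Semantics.pairEquiv A (tensorList L) x).1⟩ ::
      components L (Semantics.pairEquiv A (tensorList L) x).2

theorem length_components (L : List S) (x : Semantics.El (tensorList L)) :
    (components L x).length = L.length := by
  induction L with
  | nil => rfl
  | cons A L ih => exact congrArg (· + 1) (ih _)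

/-- Components live in a type that does not depend on the list `L`. Equalities between elements of
different but equal products can therefore be checked on components, where transports disappear. -/
theorem components_injective [SymmetricCategory S]
    [LawfulSemantics.{u, v, w} S] (L : List S) :
    Function.Injective (components L) := by
  induction L with
  | nil =>
    intro x y _
    exact (LawfulSemantics.unit_eq (S := S) x).trans (LawfulSemantics.unit_eq (S := S) y).symm
  | cons A L ih =>
    intro x y h
    obtain ⟨h₁, h₂⟩ := List.cons.inj h
    exact (Semantics.pairEquiv A (tensorList L)).injective
      (Prod.ext (eq_of_heq (Sigma.mk.inj h₁).2) (ih h₂))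

theorem components_splitEl (A B : List S) (x : Semantics.El (tensorList (A ++ B))) :
    components (A ++ B) x =
      components A (splitEl A B x).1 ++ components B (splitEl A B x).2 := by
  induction A with
  | nil => rfl
  | cons X A ih =>
    have e : components (X :: A) (splitEl (X :: A) B x).1 =
        ⟨X, (Semantics.pairEquiv X (tensorList (A ++ B)) x).1⟩ ::
          components A (splitEl A B (Semantics.pairEquiv X (tensorList (A ++ B)) x).2).1 := by
      simp only [components, splitEl, Equiv.apply_symm_apply]
    rw [e]
    exact congrArg _ (ih _)

theorem splitEl_surjective [SymmetricCategory S] [LawfulSemantics.{u, v, w} S] (A B : List S) :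
    Function.Surjective (splitEl (S := S) A B) := by
  induction A with
  | nil =>
    rintro ⟨a, b⟩
    exact ⟨b, Prod.ext (LawfulSemantics.unit_eq (S := S) a).symm rfl⟩
  | cons X A ih =>
    rintro ⟨a, b⟩
    obtain ⟨z, hz⟩ := ih ((Semantics.pairEquiv X (tensorList A) a).2, b)
    refine ⟨(Semantics.pairEquiv X (tensorList (A ++ B))).symm
      ((Semantics.pairEquiv X (tensorList A) a).1, z), ?_⟩
    simp only [splitEl, Equiv.apply_symm_apply, hz]
    exact Prod.ext (Equiv.symm_apply_apply _ _) rfl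

end Lists

/-! ### Transfer of the relational laws to the strictification. -/

namespace Strictify

variable {S : Type u} [Category.{v} S] [MonoidalCategory S] [Semantics.{u, v, w} S]

/-- The elements of the product of a list of sets. -/
abbrev El (A : Strictify S) : Type w := Semantics.El A.toObj

/-- Two equal lists have the same elements. -/
def castEl {A B : Strictify S} (h : A = B) : El A → El B :=
  cast (congrArg El h)

theorem components_castEl {A B : Strictify S} (h : A = B) (x : El A) :
    components B.objs (castEl h x) = components A.objs x := by
  subst h
  rfl

theorem castEl_surjective {A B : Strictify S} (h : A = B) :
    Function.Surjective (castEl h) := by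
  subst h
  exact fun x => ⟨x, rfl⟩

/-- An element of a tensor product splits into its two parts. -/
def split (A B : Strictify S) (x : El (A ⊗ B)) : El A × El B :=
  splitEl A.objs B.objs x

/-- A strict functor preserves tensor products and symmetries up to conjugation by `eqToHom`; on
elements this conjugation is a mere transport. -/
theorem rel_conj {A A' B B' : Strictify S} (h : A = A') (h' : B = B') (g : A' ⟶ B')
    (x : El A) (y : El B) :
    Rel (eqToHom h ≫ g ≫ eqToHom h'.symm).val x y ↔ Rel g.val (castEl h x) (castEl h' y) := by
  subst h h'
  simp only [eqToHom_refl, Category.id_comp, Category.comp_id]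
  rfl

variable [SymmetricCategory S] [LawfulSemantics.{u, v, w} S]

theorem rel_comp {A B D : Strictify S} (f : A ⟶ B) (g : B ⟶ D) (a : El A) (d : El D) :
    Rel (f ≫ g).val a d ↔ ∃ b, Rel f.val a b ∧ Rel g.val b d :=
  LawfulSemantics.rel_comp f.val g.val a d

theorem rel_id {A : Strictify S} (a b : El A) : Rel (𝟙 A : A ⟶ A).val a b ↔ a = b :=
  LawfulSemantics.rel_id a b

/-- Tensor products and symmetries of the strictification are those of the base conjugated by
`mergeIso`, so one computation serves both. -/
theorem rel_mergeIso_conj {A A' B B' : List S}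
    (f : tensorList A ⊗ tensorList B ⟶ tensorList A' ⊗ tensorList B')
    (x : Semantics.El (tensorList (A ++ B))) (y : Semantics.El (tensorList (A' ++ B'))) :
    Rel ((mergeIso A B).inv ≫ f ≫ (mergeIso A' B').hom) x y ↔
      Rel f ((Semantics.pairEquiv _ _).symm (splitEl A B x))
        ((Semantics.pairEquiv _ _).symm (splitEl A' B' y)) := by
  simp only [LawfulSemantics.rel_comp, rel_inv, rel_mergeIso, ← Equiv.eq_symm_apply]
  grind

theorem rel_tensor {A A' B B' : Strictify S} (f : A ⟶ A') (g : B ⟶ B') (x : El (A ⊗ B))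
    (y : El (A' ⊗ B')) :
    Rel (f ⊗ₘ g).val x y ↔
      Rel f.val (split A B x).1 (split A' B' y).1 ∧
        Rel g.val (split A B x).2 (split A' B' y).2 := by
  refine (rel_mergeIso_conj (f.val ⊗ₘ g.val) x y).trans ?_
  refine (LawfulSemantics.rel_tensor f.val g.val _ _).trans ?_
  erw [Equiv.apply_symm_apply, Equiv.apply_symm_apply]
  rfl

theorem rel_braiding {A B : Strictify S} (x : El (A ⊗ B)) (y : El (B ⊗ A)) :
    Rel (β_ A B).hom.val x y ↔
      (split A B x).1 = (split B A y).2 ∧ (split A B x).2 = (split B A y).1 := by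
  refine (rel_mergeIso_conj (β_ A.toObj B.toObj).hom x y).trans ?_
  refine (LawfulSemantics.rel_braiding (A := A.toObj) (B := B.toObj) _ _).trans ?_
  erw [Equiv.apply_symm_apply, Equiv.apply_symm_apply]
  rfl

end Strictify

/-- A reflexive and transitive relation on lists that is stable under concatenation and swaps
concatenated lists contains all permutations. -/
theorem rel_of_perm {α : Type*} {R : List α → List α → Prop} (refl : ∀ L, R L L)
    (trans : ∀ {L M N}, R L M → R M N → R L N)
    (append : ∀ {L L' M M'}, R L L' → R M M' → R (L ++ M) (L' ++ M'))
    (swap : ∀ L M, R (L ++ M) (M ++ L)) {L M : List α} (h : L.Perm M) : R L M := by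
  induction h with
  | nil => exact refl _
  | cons a _ ih => exact append (refl [a]) ih
  -- An adjacent transposition is the exchange of two one-letter strings, next to the unchanged
  -- tail.
  | swap a b L => exact append (swap [b] [a]) (refl L)
  | trans _ _ ih ih' => exact trans ih ih'

/-! ### Markings as strings of coloured places. -/

namespace GuardedNet

universe uP uT

variable {S : Type u} [Category.{v} S] [MonoidalCategory S] [SymmetricCategory S]
  [Semantics.{u, v, w} S] (G : GuardedNet.{uP, uT, u, v} S)

/-- The components of an element over a string of places. -/
def comps {X : Free G.ord} (x : G.El X) : List ((A : S) × Semantics.El A) :=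
  components (G.sem.obj X).objs x

/-- An element over a concatenation splits into its two parts. -/
def split (X Y : Free G.ord) (z : G.El (X ⊗ Y)) : G.El X × G.El Y :=
  Strictify.split _ _ (Strictify.castEl (G.sem.obj_tensor X Y) z)

theorem comps_split (X Y : Free G.ord) (z : G.El (X ⊗ Y)) :
    G.comps z = G.comps (G.split X Y z).1 ++ G.comps (G.split X Y z).2 :=
  (Strictify.components_castEl (G.sem.obj_tensor X Y) z).symm.trans (components_splitEl _ _ _)

theorem length_comps {X : Free G.ord} (x : G.El X) :
    (G.comps x).length = (G.sem.obj X).objs.length :=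
  length_components _ _

theorem comps_nil (x : G.El ⟨[]⟩) : G.comps x = [] :=
  List.eq_nil_of_length_eq_zero ((G.length_comps x).trans
    (congrArg (fun A : Strictify S => A.objs.length) G.sem.obj_unit))

theorem tokens_cons (p : G.net.Place) (X : List G.net.Place) (x : G.El ⟨p :: X⟩) :
    G.tokens (p :: X) x = ⟨p, (G.split ⟨[p]⟩ ⟨X⟩ x).1⟩ :: G.tokens X (G.split ⟨[p]⟩ ⟨X⟩ x).2 :=
  rfl

variable [LawfulSemantics.{u, v, w} S]

theorem split_surjective (X Y : Free G.ord) : Function.Surjective (G.split X Y) :=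
  (splitEl_surjective _ _).comp (Strictify.castEl_surjective _)

theorem comps_injective {X : Free G.ord} : Function.Injective (G.comps (X := X)) :=
  components_injective _

/-- The semantics may send one place to a list of several sets, so the cut point is not visible from
the places. It is fixed by the objects: `comps` of an element over `X` has the length of the list
assigned to `X`. -/
theorem split_eq {X Y : Free G.ord} {z : G.El (X ⊗ Y)} {x : G.El X} {y : G.El Y}
    (h : G.comps z = G.comps x ++ G.comps y) : G.split X Y z = (x, y) := by
  rw [comps_split] at h
  obtain ⟨h₁, h₂⟩ := List.append_inj h (by rw [length_comps, length_comps])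
  exact Prod.ext (G.comps_injective h₁) (G.comps_injective h₂)

theorem rel_id {X : Free G.ord} (x y : G.El X) : Rel (G.sem.map (𝟙 X)).val x y ↔ x = y := by
  rw [G.sem.map_id]
  exact Strictify.rel_id x y

theorem rel_comp {X Y Z : Free G.ord} (f : X ⟶ Y) (g : Y ⟶ Z) (x : G.El X) (z : G.El Z) :
    Rel (G.sem.map (f ≫ g)).val x z ↔
      ∃ y : G.El Y, Rel (G.sem.map f).val x y ∧ Rel (G.sem.map g).val y z := by
  rw [G.sem.map_comp]
  exact Strictify.rel_comp _ _ x z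

theorem rel_tensor {X X' Y Y' : Free G.ord} (f : X ⟶ X') (g : Y ⟶ Y') (x : G.El (X ⊗ Y))
    (y : G.El (X' ⊗ Y')) :
    Rel (G.sem.map (f ⊗ₘ g)).val x y ↔
      Rel (G.sem.map f).val (G.split X Y x).1 (G.split X' Y' y).1 ∧
        Rel (G.sem.map g).val (G.split X Y x).2 (G.split X' Y' y).2 := by
  rw [G.sem.map_tensor]
  exact (Strictify.rel_conj _ _ _ x y).trans (Strictify.rel_tensor _ _ _ _)

theorem rel_braiding {X Y : Free G.ord} (x : G.El (X ⊗ Y)) (y : G.El (Y ⊗ X)) :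
    Rel (G.sem.map (β_ X Y).hom).val x y ↔
      (G.split X Y x).1 = (G.split Y X y).2 ∧ (G.split X Y x).2 = (G.split Y X y).1 := by
  rw [G.sem.map_braiding]
  exact (Strictify.rel_conj _ _ _ x y).trans (Strictify.rel_braiding _ _)

theorem el_nil_eq (x y : G.El ⟨[]⟩) : x = y :=
  G.comps_injective ((G.comps_nil x).trans (G.comps_nil y).symm)

/-- The content is associativity of splitting. Cutting off the first token and then `Y`, or `Y` and
then the first token, yields the same three pieces, as their components show. -/
theorem tokens_split (X Y : List G.net.Place) (z : G.El ⟨X ++ Y⟩) :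
    G.tokens (X ++ Y) z =
      G.tokens X (G.split ⟨X⟩ ⟨Y⟩ z).1 ++ G.tokens Y (G.split ⟨X⟩ ⟨Y⟩ z).2 := by
  induction X with
  | nil =>
    have h := G.comps_split ⟨[]⟩ ⟨Y⟩ z
    rw [G.comps_nil] at h
    exact congrArg (G.tokens Y) (G.comps_injective h)
  | cons p X ih =>
    have h₁ := G.comps_split ⟨p :: X⟩ ⟨Y⟩ z
    have h₂ := G.comps_split ⟨[p]⟩ ⟨X⟩ (G.split ⟨p :: X⟩ ⟨Y⟩ z).1
    -- `w` glues the rest of the `X` part to the `Y` part; it turns out to be the tail of `z`.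
    obtain ⟨w, hw⟩ := G.split_surjective ⟨X⟩ ⟨Y⟩
      ((G.split ⟨[p]⟩ ⟨X⟩ (G.split ⟨p :: X⟩ ⟨Y⟩ z).1).2, (G.split ⟨p :: X⟩ ⟨Y⟩ z).2)
    have h₃ := G.comps_split ⟨X⟩ ⟨Y⟩ w
    rw [hw] at h₃
    have h₄ : G.split ⟨[p]⟩ ⟨X ++ Y⟩ z =
        ((G.split ⟨[p]⟩ ⟨X⟩ (G.split ⟨p :: X⟩ ⟨Y⟩ z).1).1, w) := by
      refine G.split_eq ?_
      rw [h₃, ← List.append_assoc, ← h₂]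
      exact h₁
    have h₅ := ih w
    rw [hw] at h₅
    refine (G.tokens_cons p (X ++ Y) z).trans ?_
    rw [h₄, h₅]
    rfl

theorem exists_tokens_eq (P : List G.ColouredPlace) :
    ∃ (X : List G.net.Place) (x : G.El ⟨X⟩), G.tokens X x = P := by
  induction P with
  | nil =>
    obtain ⟨x, -⟩ := Strictify.castEl_surjective (S := S) G.sem.obj_unit Semantics.unitEl
    exact ⟨[], x, rfl⟩
  | cons c P ih =>
    obtain ⟨X, x, rfl⟩ := ih
    obtain ⟨z, hz⟩ := G.split_surjective ⟨[c.1]⟩ ⟨X⟩ (c.2, x)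
    exact ⟨c.1 :: X, z, by rw [tokens_cons, hz]⟩

/-- The tokens record the places as well as the colours, so the underlying strings need not be
assumed equal. -/
theorem tokens_injective {X Y : List G.net.Place} {x : G.El ⟨X⟩} {y : G.El ⟨Y⟩}
    (h : G.tokens X x = G.tokens Y y) : (⟨⟨X⟩, x⟩ : G.Marking) = ⟨⟨Y⟩, y⟩ := by
  induction X generalizing Y with
  | nil =>
    cases Y with
    | nil => rw [G.el_nil_eq x y]
    | cons q Y => cases h
  | cons p X ih =>
    cases Y with
    | nil => cases h
    | cons q Y =>
      rw [tokens_cons, tokens_cons] at h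
      obtain ⟨h₁, h₂⟩ := List.cons.inj h
      obtain ⟨rfl, h₁⟩ := Sigma.mk.inj h₁
      obtain ⟨h₃, h₄⟩ := Marking.mk.inj (ih h₂)
      obtain rfl : X = Y := congrArg Free.word h₃
      have h₅ := G.comps_split ⟨[p]⟩ ⟨X⟩ x
      rw [eq_of_heq h₁, eq_of_heq h₄, ← comps_split] at h₅
      rw [G.comps_injective h₅]

/-! ### From the internal net to the guarded net. -/

/-- Reachability between strings of generating objects. -/
def TokensReachable (P Q : List G.ColouredPlace) : Prop :=
  ∀ A B : G.Marking, G.tokens A.obj.word A.elt = P → G.tokens B.obj.word B.elt = Q →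
    G.Reachable A B

variable {G}

namespace TokensReachable

theorem refl (P : List G.ColouredPlace) : G.TokensReachable P P := by
  rintro ⟨X, x⟩ ⟨Y, y⟩ hA hB
  have h := G.tokens_injective (hA.trans hB.symm)
  obtain ⟨h₁, h₂⟩ := Marking.mk.inj h
  obtain rfl : X = Y := h₁
  exact ⟨𝟙 X, (G.rel_id x y).2 (eq_of_heq h₂)⟩

theorem trans {P Q R : List G.ColouredPlace} (h : G.TokensReachable P Q)
    (h' : G.TokensReachable Q R) : G.TokensReachable P R := by
  intro A B hA hB
  -- The hypotheses quantify over all markings with given tokens; surjectivity of `tokens` supplies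
  -- an actual marking to pass through.
  obtain ⟨X, x, hx⟩ := G.exists_tokens_eq Q
  obtain ⟨f, hf⟩ := h A ⟨⟨X⟩, x⟩ hA hx
  obtain ⟨g, hg⟩ := h' ⟨⟨X⟩, x⟩ B hx hB
  exact ⟨f ≫ g, (G.rel_comp f g A.elt B.elt).2 ⟨x, hf, hg⟩⟩

/-- A token string determines its marking, so one pair of markings decides the universally
quantified statement. -/
theorem mk {A B : G.Marking} (h : G.Reachable A B) :
    G.TokensReachable (G.tokens A.obj.word A.elt) (G.tokens B.obj.word B.elt) := by
  intro A' B' hA hB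
  obtain rfl : A' = A := G.tokens_injective hA
  obtain rfl : B' = B := G.tokens_injective hB
  exact h

theorem append {P P' Q Q' : List G.ColouredPlace} (h : G.TokensReachable P P')
    (h' : G.TokensReachable Q Q') : G.TokensReachable (P ++ Q) (P' ++ Q') := by
  obtain ⟨X, x, hx⟩ := G.exists_tokens_eq P
  obtain ⟨X', x', hx'⟩ := G.exists_tokens_eq P'
  obtain ⟨Y, y, hy⟩ := G.exists_tokens_eq Q
  obtain ⟨Y', y', hy'⟩ := G.exists_tokens_eq Q'
  obtain ⟨f, hf⟩ := h ⟨⟨X⟩, x⟩ ⟨⟨X'⟩, x'⟩ hx hx'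
  obtain ⟨g, hg⟩ := h' ⟨⟨Y⟩, y⟩ ⟨⟨Y'⟩, y'⟩ hy hy'
  obtain ⟨z, hz⟩ := G.split_surjective ⟨X⟩ ⟨Y⟩ (x, y)
  obtain ⟨z', hz'⟩ := G.split_surjective ⟨X'⟩ ⟨Y'⟩ (x', y')
  have e := G.tokens_split X Y z
  have e' := G.tokens_split X' Y' z'
  rw [hz, hx, hy] at e
  rw [hz', hx', hy'] at e'
  rw [← e, ← e']
  refine mk (A := ⟨_, z⟩) (B := ⟨_, z'⟩) ⟨f ⊗ₘ g, (G.rel_tensor f g z z').2 ?_⟩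
  rw [hz, hz']
  exact ⟨hf, hg⟩

theorem swap (P Q : List G.ColouredPlace) : G.TokensReachable (P ++ Q) (Q ++ P) := by
  obtain ⟨X, x, hx⟩ := G.exists_tokens_eq P
  obtain ⟨Y, y, hy⟩ := G.exists_tokens_eq Q
  obtain ⟨z, hz⟩ := G.split_surjective ⟨X⟩ ⟨Y⟩ (x, y)
  obtain ⟨z', hz'⟩ := G.split_surjective ⟨Y⟩ ⟨X⟩ (y, x)
  have e := G.tokens_split X Y z
  have e' := G.tokens_split Y X z'
  rw [hz, hx, hy] at e
  rw [hz', hx, hy] at e'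
  rw [← e, ← e']
  refine mk (A := ⟨_, z⟩) (B := ⟨_, z'⟩) ⟨(β_ _ _).hom, (G.rel_braiding z z').2 ?_⟩
  rw [hz, hz']
  exact ⟨rfl, rfl⟩

theorem of_perm {P Q : List G.ColouredPlace} (h : P.Perm Q) : G.TokensReachable P Q :=
  rel_of_perm refl trans append swap h

theorem of_term (o : G.internalNet.Ordering) {P Q : List G.internalNet.Place} (f : Term o P Q) :
    G.TokensReachable P Q := by
  induction f with
  | id P => exact refl P
  | cast h => exact h ▸ refl _
  | comp _ _ ih ih' => exact trans ih ih'
  | tensor _ _ ih ih' => exact append ih ih'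
  | braid P Q => exact swap P Q
  | gen τ =>
    -- `o` orders the inputs and outputs of `τ` arbitrarily, so permutations before and after are
    -- needed to reach the token order.
    refine trans (of_perm (Multiset.coe_eq_coe.1 (o.coe_src τ)))
      (trans ?_ (of_perm (Multiset.coe_eq_coe.1 (o.coe_tgt τ)).symm))
    exact mk (A := ⟨_, τ.source⟩) (B := ⟨_, τ.target⟩) ⟨τ.hom.base, ⟨τ.hom.path⟩⟩

end TokensReachable

/-! ### From the guarded net to the internal net. -/

theorem nonempty_term_of_perm {N : PetriNet.{u, v}} (o : N.Ordering) {P Q : List N.Place}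
    (h : P.Perm Q) : Nonempty (Term o P Q) :=
  rel_of_perm (R := fun P Q => Nonempty (Term o P Q)) (fun P => ⟨.id P⟩)
    (fun ⟨f⟩ ⟨g⟩ => ⟨f.comp g⟩) (fun ⟨f⟩ ⟨g⟩ => ⟨f.tensor g⟩) (fun P Q => ⟨.braid P Q⟩) h

/-- The induction runs over formal terms, with the endpoints `x` and `y` left free: a composite
requires its hypotheses at an intermediate element that depends on the chosen way. -/
theorem nonempty_internal_term (o : G.internalNet.Ordering) {X Y : List G.net.Place}
    (f : Term G.ord X Y) (x : G.El ⟨X⟩) (y : G.El ⟨Y⟩)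
    (h : Rel (G.sem.map (Free.homMk f : (⟨X⟩ : Free G.ord) ⟶ ⟨Y⟩)).val x y) :
    Nonempty (Term o (G.tokens X x) (G.tokens Y y)) := by
  induction f with
  | id X =>
    obtain rfl := (G.rel_id x y).1 h
    exact ⟨.id _⟩
  | cast e =>
    subst e
    rw [Free.homMk_cast] at h
    obtain rfl := (G.rel_id x y).1 h
    exact ⟨.id _⟩
  | comp f g ih ih' =>
    obtain ⟨z, h₁, h₂⟩ := (G.rel_comp (Free.homMk f) (Free.homMk g) x y).1 h
    obtain ⟨f'⟩ := ih x z h₁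
    obtain ⟨g'⟩ := ih' z y h₂
    exact ⟨f'.comp g'⟩
  | @tensor X X' Y Y' f g ih ih' =>
    obtain ⟨h₁, h₂⟩ := (G.rel_tensor (X := ⟨X⟩) (X' := ⟨X'⟩) (Y := ⟨Y⟩) (Y' := ⟨Y'⟩)
      (Free.homMk f) (Free.homMk g) x y).1 h
    obtain ⟨f'⟩ := ih _ _ h₁
    obtain ⟨g'⟩ := ih' _ _ h₂
    rw [tokens_split, tokens_split]
    exact ⟨f'.tensor g'⟩
  | braid X Y =>
    obtain ⟨h₁, h₂⟩ := (G.rel_braiding (X := ⟨X⟩) (Y := ⟨Y⟩) x y).1 h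
    rw [tokens_split, tokens_split, h₁, h₂]
    exact ⟨.braid _ _⟩
  | gen t =>
    obtain ⟨s⟩ := h
    -- The way `s` from `x` to `y` along `t` is exactly the datum of a transition of the internal
    -- net over `t`.
    let τ : G.GeneratingHom := ⟨t, x, y, ⟨Free.gen G.ord t, s⟩, rfl⟩
    obtain ⟨f⟩ := nonempty_term_of_perm o (Multiset.coe_eq_coe.1 (o.coe_src τ)).symm
    obtain ⟨g⟩ := nonempty_term_of_perm o (Multiset.coe_eq_coe.1 (o.coe_tgt τ))
    exact ⟨f.comp ((Term.gen (o := o) τ).comp g)⟩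

/-- Reachability in a guarded net with semantics in a category of sets whose morphisms compose and
tensor like relations is reachability in the net underlying the internalization. -/
theorem reachable_iff_netReachable (o : G.internalNet.Ordering) (A B : G.Marking) :
    G.Reachable A B ↔ NetReachable o (A.toInternal o) (B.toInternal o) := by
  constructor
  · rintro ⟨f, hf⟩
    induction f using Quotient.ind with
    | _ f =>
      obtain ⟨g⟩ := nonempty_internal_term o f A.elt B.elt hf
      exact ⟨Free.homMk g⟩
  · rintro ⟨f⟩
    induction f using Quotient.ind with
    | _ f => exact TokensReachable.of_term o f A B rfl rfl

end GuardedNet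

end GuardedNets

theorem mainTheorem2 :
    (∀ (G : GuardedNets.GuardedNet.{u, v} GuardedNets.SetStar.{w}) (o : G.internalNet.Ordering)
        (A B : G.Marking),
      G.Reachable A B ↔ GuardedNets.NetReachable o (A.toInternal o) (B.toInternal o)) ∧
    (∀ (G : GuardedNets.GuardedNet.{u, v} GuardedNets.SpanCat.{w}) (o : G.internalNet.Ordering)
        (A B : G.Marking),
      G.Reachable A B ↔ GuardedNets.NetReachable o (A.toInternal o) (B.toInternal o)) := by
  exact ⟨fun _ => GuardedNets.GuardedNet.reachable_iff_netReachable,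
    fun _ => GuardedNets.GuardedNet.reachable_iff_netReachable⟩
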